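/- **Setting.** Let $F$ be a real Fréchet space. A map between open subsets of Fréchet spaces is (Keller) $C^1$ if it is continuous, has all directional derivatives $Df(x)h=\lim_{t\to0}\frac{f(x+th)-f(x)}{t}$, each $Df(x)$ is a continuous linear map, and $x\mapsto Df(x)$ is continuous for the topology of uniform convergence on compact sets. Let $M$ be a connected, Hausdorff, second countable manifold modelled on $F$ with $C^1$ transition maps. Let $(\|\cdot\|_n)_{n\ge1}$ be a graded Finsler structure on $TM$: functions $\|\cdot\|_n:TM\to[0,\infty)$ with $\|\cdot\|_n\le\|\cdot\|_{n+1}$ which on each $T_xM$ are seminorms inducing its topology, and such that every point of $M$ lies in an open set $V$ over which, in the bundle chart of $TM$ given by some chart of $M$, they are continuous functions $(x,v)\mapsto\|v\|_n^x$ on $V\times F$ with the property: for all $k>1$ and $y\in V$ there is a neighbourhood $W\subseteq V$ of $y$ such that $\frac1k\|v\|_n^{y}\le\|v\|_n^{w}\le k\|v\|_n^{y}$ for all $w\in W$, $n\ge1$, $v\in F$. Let $\rho_n(x,y)$ be the infimum of the lengths $\int\|\gamma'(t)\|_n^{\gamma(t)}\,dt$ of the piecewise $C^1$ paths $\gamma$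 from $x$ to $y$, and let $$\rho(x,y)=\sum_{n=1}^\infty\frac1{2^n}\,\frac{\rho_n(x,y)}{1+\rho_n(x,y)} .$$ Assume that $M$ is endowed with $\rho$ as a complete metric (a metric that induces the topology of $M$). For a $C^1$ functional $\varphi:M\to\mathbb R$ let $\Phi_\varphi(x)=\inf\{\varphi'(x,h): h\in T_xM,\ \|h\|_n\le1\text{ for all }n\}$, where $\varphi'(x,h)$ is the derivative of $\varphi$ at $x$ along $h$. The functional satisfies $(\mathrm{PS})_c$ if every sequence $(m_j)$ in $M$ with $\varphi(m_j)\to c$ and $\Phi_\varphi(m_j)\to0$ has a convergent subsequence. A point $x$ is critical if the derivative of $\varphi$ in a chart at $x$ vanishes there; $\mathrm{Cr}(\varphi,c)$ is the set of critical points $x$ with $\varphi(x)=c$. The functional is closed if it maps closed sets to closed sets. **Theorem (mountain pass theorem).** Let $U\subseteq M$ be open, $x_0\in U$ and $x_1\in M\setminus\overline U$. Let $\varphi:M\to\mathbb R$ be a closed $C^1$ functional such that 1. $\max\{\varphi(x_0),\varphi(x_1)\}\le i:=\inf_{\partial U}\varphi$ (in particular, $\varphi$ is bounded below on $\partial U$);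 2. $\varphi$ satisfies $(\mathrm{PS})_c$ at $$c:=\inf_{h}\ \sup_{t\in[0,1]}\varphi(h(t)),$$ where $h$ runs over the continuous maps $h:[0,1]\to M$ with $h(0)=x_0$ and $h(1)=x_1$. Then $c$ is well defined and finite (such $h$ exist, and the suprema are finite and bounded below), $c$ is a critical value of $\varphi$, that is, $\mathrm{Cr}(\varphi,c)\ne\emptyset$, and $c\ge i$. If $c=i$, then $\mathrm{Cr}(\varphi,c)\cap\partial U\ne\emptyset$. -/

import Mathlib

open Set Filter Topology
open scoped CompactConvergenceCLM Manifold

noncomputable section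

namespace FrechetMPT

/-! ### Keller `C¹` maps between locally convex spaces -/

section Keller

variable {E F : Type*}
  [AddCommGroup E] [Module ℝ E] [TopologicalSpace E]
  [AddCommGroup F] [Module ℝ F] [TopologicalSpace F]

/-- `f` has directional derivative `y` at `x` in the direction `h`:
`(f (x + t h) - f x) / t → y` as `t → 0`, `t ≠ 0`. -/
def HasDirDeriv (f : E → F) (x h : E) (y : F) : Prop :=
  Tendsto (fun t : ℝ => t⁻¹ • (f (x + t • h) - f x)) (𝓝[≠] (0 : ℝ)) (𝓝 y)

/-- The value of the directional derivative (only used where it exists). -/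
def dirDeriv (f : E → F) (x h : E) : F :=
  limUnder (𝓝[≠] (0 : ℝ)) (fun t : ℝ => t⁻¹ • (f (x + t • h) - f x))

/-- Keller `C¹` on an open set `U`: `f` is continuous on `U`, all directional derivatives exist at
the points of `U`, they are given by continuous linear maps `f' x`, and `x ↦ f' x` is continuous
on `U` for the topology of uniform convergence on compact sets on the space of continuous linear
maps. -/
def KellerC1On [IsTopologicalAddGroup F] [ContinuousConstSMul ℝ F]
    (f : E → F) (U : Set E) : Prop :=
  ContinuousOn f U ∧ ∃ f' : E → (E →L_c[ℝ] F),
    (∀ x ∈ U, ∀ h : E, HasDirDeriv f x h (f' x h)) ∧ ContinuousOn f' U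

end Keller

/-! ### `C¹` manifolds modelled on `F`, functionals on them, curves -/

section Manifold

variable (F : Type*) [AddCommGroup F] [Module ℝ F] [TopologicalSpace F]

/-- All coordinate transition maps of the atlas are Keller `C¹`. -/
def IsC1Manifold [IsTopologicalAddGroup F] [ContinuousConstSMul ℝ F]
    (M : Type*) [TopologicalSpace M] [ChartedSpace F M] : Prop :=
  ∀ e ∈ atlas F M, ∀ e' ∈ atlas F M, KellerC1On (e' ∘ e.symm) (e.symm.trans e').source

variable {F} in
/-- A chart of the maximal `C¹` atlas: its transition maps with all charts of the atlas are
Keller `C¹`. -/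
def IsC1Chart [IsTopologicalAddGroup F] [ContinuousConstSMul ℝ F]
    {M : Type*} [TopologicalSpace M] [ChartedSpace F M] (e : OpenPartialHomeomorph M F) : Prop :=
  ∀ e' ∈ atlas F M, KellerC1On (e' ∘ e.symm) (e.symm.trans e').source ∧
    KellerC1On (e ∘ e'.symm) (e'.symm.trans e).source

variable {M : Type*} [TopologicalSpace M] [ChartedSpace F M]

/-- A functional `φ : M → ℝ` of class `C¹`. -/
def IsC1Functional (φ : M → ℝ) : Prop :=
  ∀ e ∈ atlas F M, KellerC1On (φ ∘ e.symm) e.target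

/-- `x` is a critical point of `φ`: in a chart at `x` the derivative of `φ ∘ e⁻¹` at `e x` is
zero. -/
def IsCriticalPt (φ : M → ℝ) (x : M) : Prop :=
  ∃ e ∈ atlas F M, x ∈ e.source ∧ ∀ h : F, HasDirDeriv (φ ∘ e.symm) (e x) h 0

/-- The critical points of `φ` at the level `c`. -/
def criticalSet (φ : M → ℝ) (c : ℝ) : Set M :=
  {x | IsCriticalPt F φ x ∧ φ x = c}

/-! As in Mathlib's tangent bundle, the tangent space `T_x M` is the model space `F`, a tangent
vector at `x` being represented by its coordinates in the preferred chart `chartAt F x`. -/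

variable {F} in
/-- The tangent vector at `x` (in the representation above) whose coordinates in the chart `e` are
`v`; thus `(x, v) ↦ (x, fromChart e x v)` is the bundle chart of `TM` over `e.source`. -/
def fromChart (e : OpenPartialHomeomorph M F) (x : M) (v : F) : F :=
  dirDeriv (chartAt F x ∘ e.symm) (e x) v

/-- The derivative `φ'(x, h)` of `φ` at `x` along `h ∈ T_x M`. -/
def tangentDeriv (φ : M → ℝ) (x : M) (h : F) : ℝ :=
  dirDeriv (φ ∘ (chartAt F x).symm) (chartAt F x x) h

/-- `γ` is a `C¹` curve on `[a, b]`: it is continuous and in every chart it has a derivative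
(one-sided at the end points) that is continuous on the part of `[a, b]` that `γ` maps to the
chart. -/
def IsC1Curve (γ : ℝ → M) (a b : ℝ) : Prop :=
  ContinuousOn γ (Icc a b) ∧ ∀ e ∈ atlas F M, ∃ g : ℝ → F,
    ContinuousOn g (Icc a b ∩ γ ⁻¹' e.source) ∧
    ∀ t ∈ Icc a b ∩ γ ⁻¹' e.source,
      Tendsto (fun s : ℝ => (s - t)⁻¹ • (e (γ s) - e (γ t))) (𝓝[Icc a b \ {t}] t) (𝓝 (g t))

/-- The velocity `γ'(t) ∈ T_{γ(t)} M` of a `C¹` curve on `[a, b]`. -/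
def velocity (γ : ℝ → M) (a b t : ℝ) : F :=
  limUnder (𝓝[Icc a b \ {t}] t)
    (fun s : ℝ => (s - t)⁻¹ • (chartAt F (γ t) (γ s) - chartAt F (γ t) (γ t)))

/-- A piecewise `C¹` path from `x` to `y`: a curve `γ` on `[τ 0, τ m]`, where
`τ 0 < τ 1 < ⋯ < τ m`, that is `C¹` on each `[τ i, τ (i + 1)]`. -/
structure PiecewiseC1Path (x y : M) where
  γ : ℝ → M
  m : ℕ
  τ : ℕ → ℝ
  lt : ∀ i < m, τ i < τ (i + 1)
  c1 : ∀ i < m, IsC1Curve F γ (τ i) (τ (i + 1))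
  source : γ (τ 0) = x
  target : γ (τ m) = y

end Manifold

/-! ### Finsler structures -/

section Finsler

variable (F : Type*) [AddCommGroup F] [Module ℝ F] [TopologicalSpace F]
  [IsTopologicalAddGroup F] [ContinuousConstSMul ℝ F]
  (M : Type*) [TopologicalSpace M] [ChartedSpace F M]

/-- A graded Finsler structure on `TM`: an increasing sequence of functions on `TM` that on each
fibre are seminorms inducing the topology of the fibre, and such that around every point there is
a bundle chart in which they are continuous functions satisfying the uniform comparison
inequality. (The numbering starts at `0`.) -/
structure FinslerStructure where
  /-- The `n`-th seminorm on `T_x M`. -/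
  N : ℕ → M → Seminorm ℝ F
  graded : ∀ n x, N n x ≤ N (n + 1) x
  withSeminorms : ∀ x, WithSeminorms (fun n => N n x)
  bundleChart : ∀ x : M, ∃ e : OpenPartialHomeomorph M F, IsC1Chart e ∧
    ∃ U : Set M, IsOpen U ∧ x ∈ U ∧ U ⊆ e.source ∧
      (∀ n, ContinuousOn (fun p : M × F => N n p.1 (fromChart e p.1 p.2)) (U ×ˢ univ)) ∧
      ∀ k : ℝ, 1 < k → ∀ x₀ ∈ U, ∃ W ∈ 𝓝 x₀, ∀ w ∈ W ∩ U, ∀ n, ∀ v : F,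
        k⁻¹ * N n x₀ (fromChart e x₀ v) ≤ N n w (fromChart e w v) ∧
        N n w (fromChart e w v) ≤ k * N n x₀ (fromChart e x₀ v)

variable {F M}

/-- The length of a piecewise `C¹` path with respect to the `n`-th component. -/
def PiecewiseC1Path.length {x y : M} (p : PiecewiseC1Path F x y) (S : FinslerStructure F M)
    (n : ℕ) : ℝ :=
  ∑ i ∈ Finset.range p.m, ∫ t in (p.τ i)..(p.τ (i + 1)),
    S.N n (p.γ t) (velocity F p.γ (p.τ i) (p.τ (i + 1)) t)

/-- The distance with respect to the `n`-th component: the infimum of the lengths. -/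
def FinslerStructure.compDist (S : FinslerStructure F M) (n : ℕ) (x y : M) : ℝ :=
  ⨅ p : PiecewiseC1Path F x y, p.length S n

/-- The Finsler distance `∑ₙ 2⁻ⁿ ρₙ / (1 + ρₙ)`, the sum starting with the weight `1 / 2`. -/
def FinslerStructure.finslerDist (S : FinslerStructure F M) (x y : M) : ℝ :=
  ∑' n : ℕ, (1 / 2 : ℝ) ^ (n + 1) * (S.compDist n x y / (1 + S.compDist n x y))

/-- The intersection of the closed unit semi-balls of `T_x M`. -/
def FinslerStructure.unitBall (S : FinslerStructure F M) (x : M) : Set F :=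
  {h | ∀ n, S.N n x h ≤ 1}

/-- `Φ_φ(x)`, the infimum of `φ'(x, h)` over `h` in the intersection of the unit semi-balls. -/
def FinslerStructure.Phi (S : FinslerStructure F M) (φ : M → ℝ) (x : M) : ℝ :=
  sInf (tangentDeriv F φ x '' S.unitBall x)

/-- The Palais–Smale condition at the level `c`. -/
def FinslerStructure.PalaisSmale (S : FinslerStructure F M) (φ : M → ℝ) (c : ℝ) : Prop :=
  ∀ u : ℕ → M, Tendsto (fun j => φ (u j)) atTop (𝓝 c) →
    Tendsto (fun j => S.Phi φ (u j)) atTop (𝓝 0) →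
    ∃ x : M, ∃ s : ℕ → ℕ, StrictMono s ∧ Tendsto (u ∘ s) atTop (𝓝 x)

end Finsler

/-- `inf_h sup_t φ (h t)` over the continuous paths `h : [0,1] → M` from `x₀` to `x₁`. -/
def minimaxLevel {M : Type*} [TopologicalSpace M] (φ : M → ℝ) (x₀ x₁ : M) : ℝ :=
  ⨅ h : Path x₀ x₁, ⨆ t : unitInterval, φ (h t)

end FrechetMPT

end

/-!
The idea. Fix a closed set `A` that separates `x₀` from `x₁` and on which `φ ≥ c`, where `c` is the
minimax level: the superlevel set `{φ ≥ c}` if `c > i`, and the frontier of `U` if `c = i`. It is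
shown that `A` contains a critical point at the level `c`. Since vector fields on Fréchet spaces
need not have flows, everything is done with local deformations along straight lines in charts.

There are two kinds of them. If `Φ_φ(x) < -δ`, then an admissible direction at `x`, moved in the
bundle chart, stays admissible near `x` up to a factor `2`, the comparison of the seminorms being
uniform in their index. The lines in this direction have speed at most `1` for `ρ`, and `φ`
decreases along them at the rate `δ / 2` (`FinslerStructure.descendsAt_of_Phi_lt`): in the
terminology of Degiovanni and Marzocchi, `φ` has positive weak slope at `x`. If `x` is merely not
critical, there is still a chart direction along which `φ` decreases
(`descendsTopologicallyAt_of_not_isCriticalPt`), but it need not be proportional to an admissible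
one, and nothing is known about the distances. This distinction is essential, because the vectors
on which all the seminorms are bounded may form a small subspace of the tangent space, so that
`Φ_φ(x) = 0` does not make `x` critical.

With the first kind, a variant of the argument of Ghoussoub and Preiss applies: Ekeland's principle
for `g ↦ sup_t (φ (g t) - b d(g t, A))` on a space of paths yields points near `A` and near the
level `c` with small weak slope (`IsSeparating.not_uniform_descent`), hence by the Palais–Smale
condition a point of weak slope zero in `A` (`IsSeparating.exists_not_descendsAt`). The deformation of an
Ekeland path is put together from finitely many local ones, which take turns in bringing the time
of motion of every parameter up to a common value (`exists_isDescent`).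

The points of weak slope zero in `A` at the level `c` form a compact set, again by the Palais–Smale
condition. If none of them were critical, finitely many local deformations `η` of the second kind
would handle them all. The preimage `η ⁻¹' A` is again a separating set with `φ ≥ c`, and its points
at the level `c` are points of `A` that `η` does not move. After finitely many such steps there is
a separating set without points of weak slope zero at the level `c`, a contradiction
(`IsSeparating.exists_not_descendsTopologicallyAt`). This step uses only
the continuity of the deformations, so no control of distances is needed.
-/

namespace FrechetMPT

/-! ### Calculus of Keller `C¹` maps -/

/-- A directional derivative is the derivative along a line. -/
theorem HasDirDeriv.hasDerivAt {E : Type*} [AddCommGroup E] [Module ℝ E]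
    {f : E → ℝ} {x v : E} {θ d : ℝ}
    (h : HasDirDeriv f (x + θ • v) v d) : HasDerivAt (fun s : ℝ => f (x + s • v)) d θ := by
  rw [hasDerivAt_iff_tendsto_slope_zero]
  refine h.congr fun t => ?_
  rw [add_smul, add_assoc]

section Calculus

variable {E G : Type*} [AddCommGroup E] [Module ℝ E] [TopologicalSpace E]
  [AddCommGroup G] [Module ℝ G] [TopologicalSpace G]

/-- Continuity of the derivative for compact convergence gives joint continuity of
`(x, h) ↦ f' x h`: a convergent sequence of directions together with its limit is a compact set. -/
theorem KellerC1On.exists_deriv [FirstCountableTopology E] [IsTopologicalAddGroup G]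
    [ContinuousConstSMul ℝ G] {f : E → G} {U : Set E} (hf : KellerC1On f U) (hU : IsOpen U) :
    ∃ D : E → E →L[ℝ] G, (∀ x ∈ U, ∀ h, HasDirDeriv f x h (D x h)) ∧
      ∀ x ∈ U, ∀ h, ContinuousAt (fun p : E × E => D p.1 p.2) (x, h) := by
  obtain ⟨-, f', hf', hc⟩ := hf
  refine ⟨fun x => (ContinuousLinearMap.toUniformConvergenceCLM (RingHom.id ℝ) G
    {S : Set E | IsCompact S}).symm (f' x), fun x hx h => hf' x hx h, fun x hx h => ?_⟩
  refine tendsto_of_seq_tendsto fun u hu => ?_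
  have hu1 : Tendsto (fun n => (u n).1) atTop (𝓝 x) := (continuous_fst.tendsto _).comp hu
  have hu2 : Tendsto (fun n => (u n).2) atTop (𝓝 h) := (continuous_snd.tendsto _).comp hu
  have hfx : Tendsto (fun n => f' (u n).1 - f' x) atTop (𝓝 0) := by
    have := ((hc.continuousAt (hU.mem_nhds hx)).tendsto.comp hu1).sub
      (tendsto_const_nhds (x := f' x))
    simpa using this
  have h0 : Tendsto (fun n => (f' (u n).1 - f' x) (u n).2) atTop (𝓝 0) := by
    intro V hV
    rw [mem_map]
    have hK : IsCompact (insert h (range fun n => (u n).2)) := hu2.isCompact_insert_range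
    filter_upwards [hfx.eventually (UniformConvergenceCLM.eventually_nhds_zero_mapsTo
      (RingHom.id ℝ) (𝔖 := {S : Set E | IsCompact S}) hK hV)] with n hn
    exact hn (mem_insert_of_mem _ (mem_range_self n))
  have h1 : Tendsto (fun n => f' x (u n).2) atTop (𝓝 (f' x h)) :=
    ((map_continuous (f' x)).tendsto h).comp hu2
  have := h0.add h1
  rw [zero_add] at this
  refine this.congr fun n => ?_
  change f' (u n).1 (u n).2 - f' x (u n).2 + f' x (u n).2 = _
  rw [sub_add_cancel]
  rfl

/-- The chain rule for a real Keller `C¹` function along a curve that is differentiable at one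
point. By the mean value theorem, the difference quotient is the value of the jointly continuous
derivative at nearby arguments. -/
theorem tendsto_slope_comp [IsTopologicalAddGroup E] [ContinuousSMul ℝ E]
    [LocallyConvexSpace ℝ E] {f : E → ℝ} {U : Set E} (hU : IsOpen U) {D : E → E →L[ℝ] ℝ}
    (hD : ∀ x ∈ U, ∀ h, HasDirDeriv f x h (D x h)) {c : ℝ → E} {y : E} (hx : c 0 ∈ U)
    (hDc : ContinuousAt (fun p : E × E => D p.1 p.2) (c 0, y))
    (hc : Tendsto (fun t : ℝ => t⁻¹ • (c t - c 0)) (𝓝[≠] 0) (𝓝 y)) :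
    Tendsto (fun t : ℝ => t⁻¹ • (f (c t) - f (c 0))) (𝓝[≠] 0) (𝓝 (D (c 0) y)) := by
  have hc0 : Tendsto c (𝓝[≠] 0) (𝓝 (c 0)) := by
    have ht : Tendsto (fun t : ℝ => t) (𝓝[≠] 0) (𝓝 0) :=
      tendsto_nhdsWithin_of_tendsto_nhds tendsto_id
    have := (ht.smul hc).add_const (c 0)
    rw [zero_smul, zero_add] at this
    refine this.congr' ?_
    filter_upwards [self_mem_nhdsWithin] with t ht
    rw [smul_inv_smul₀ ht, sub_add_cancel]
  intro V hV
  have hV' := hDc hV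
  rw [mem_map, nhds_prod_eq, mem_prod_iff] at hV'
  obtain ⟨A, hA, B, hB, hAB⟩ := hV'
  obtain ⟨A', ⟨hA', hconv⟩, hAA'⟩ :=
    (LocallyConvexSpace.convex_basis (𝕜 := ℝ) (c 0)).mem_iff.1 (inter_mem hA (hU.mem_nhds hx))
  rw [id] at hAA'
  rw [mem_map]
  filter_upwards [hc0 hA', hc hB, self_mem_nhdsWithin] with t ht1 ht2 ht3
  have hmem : ∀ θ ∈ Icc (0 : ℝ) 1, c 0 + θ • (c t - c 0) ∈ A' := fun θ hθ =>
    hconv.add_smul_sub_mem (mem_of_mem_nhds hA') ht1 hθ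
  have hder : ∀ θ ∈ Icc (0 : ℝ) 1, HasDerivAt (fun s : ℝ => f (c 0 + s • (c t - c 0)))
      (D (c 0 + θ • (c t - c 0)) (c t - c 0)) θ := fun θ hθ =>
    (hD _ (hAA' (hmem θ hθ)).2 _).hasDerivAt
  obtain ⟨θ, hθ, hθ'⟩ := exists_hasDerivAt_eq_slope _ _ zero_lt_one
    (fun θ hθ => (hder θ hθ).continuousAt.continuousWithinAt)
    (fun θ hθ => hder θ (Ioo_subset_Icc_self hθ))
  have hval : t⁻¹ • (f (c t) - f (c 0)) =
      D (c 0 + θ • (c t - c 0)) (t⁻¹ • (c t - c 0)) := by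
    rw [map_smul, hθ']
    simp
  have hmem' : (c 0 + θ • (c t - c 0), t⁻¹ • (c t - c 0)) ∈ A ×ˢ B :=
    ⟨(hAA' (hmem θ (Ioo_subset_Icc_self hθ))).1, ht2⟩
  rw [mem_preimage, hval]
  exact hAB hmem'

/-- The derivatives of two mutually inverse Keller `C¹` maps are inverse to each other. Continuous
functionals reduce this to the chain rule for real functions. -/
theorem deriv_deriv_inverse [IsTopologicalAddGroup E] [ContinuousSMul ℝ E]
    [LocallyConvexSpace ℝ E] [T2Space E] {f g : E → E} {U : Set E} (hU : IsOpen U)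
    {D : E → E →L[ℝ] E} (hD : ∀ x ∈ U, ∀ h, HasDirDeriv f x h (D x h)) {x v w : E}
    (hg : HasDirDeriv g x v w) (hx : g x ∈ U)
    (hDc : ContinuousAt (fun p : E × E => D p.1 p.2) (g x, w))
    (hfg : ∀ᶠ z in 𝓝 x, f (g z) = z) : D (g x) w = v := by
  by_contra hne
  obtain ⟨l, hl⟩ := SeparatingDual.exists_ne_zero (R := ℝ) (sub_ne_zero.2 hne)
  refine hl ?_
  rw [map_sub, sub_eq_zero]
  have hlD : ∀ x ∈ U, ∀ h, HasDirDeriv (l ∘ f) x h ((l.comp (D x)) h) := fun x hx h => by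
    refine ((l.continuous.tendsto _).comp (hD x hx h)).congr fun t => ?_
    simp
  have h1 := tendsto_slope_comp (D := fun x => l.comp (D x)) (c := fun t : ℝ => g (x + t • v))
    (y := w) hU hlD (by simpa using hx) (by
      rw [zero_smul, add_zero]
      exact ContinuousAt.comp (f := fun p : E × E => D p.1 p.2) l.continuous.continuousAt hDc) (by
      simp only [zero_smul, add_zero]
      exact hg)
  have hline : Tendsto (fun t : ℝ => x + t • v) (𝓝[≠] 0) (𝓝 x) := by
    refine tendsto_nhdsWithin_of_tendsto_nhds ?_
    have : Continuous fun t : ℝ => x + t • v := by fun_prop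
    simpa using this.tendsto 0
  have h2 : Tendsto (fun t : ℝ => t⁻¹ • ((l ∘ f) (g (x + t • v)) - (l ∘ f) (g (x + (0 : ℝ) • v))))
      (𝓝[≠] 0) (𝓝 (l v)) := by
    refine tendsto_const_nhds.congr' ?_
    filter_upwards [hline.eventually hfg, self_mem_nhdsWithin] with t ht ht0
    have hx0 : f (g x) = x := hfg.self_of_nhds
    rw [zero_smul, add_zero, Function.comp, Function.comp, ht, hx0, map_add, map_smul,
      add_sub_cancel_left, inv_smul_smul₀ ht0]
  have := tendsto_nhds_unique h1 h2
  simpa using this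

end Calculus

/-! ### Straight lines in charts and their Finsler length -/

theorem HasDirDeriv.dirDeriv_eq {F : Type*} [AddCommGroup F] [Module ℝ F] [TopologicalSpace F]
    [T2Space F] {f : F → F} {x v y : F} (h : HasDirDeriv f x v y) :
    dirDeriv f x v = y :=
  h.limUnder_eq

theorem FinslerStructure.length_nonneg {F : Type*} [AddCommGroup F] [Module ℝ F]
    [TopologicalSpace F] [IsTopologicalAddGroup F] [ContinuousSMul ℝ F] {M : Type*}
    [TopologicalSpace M] [ChartedSpace F M] (S : FinslerStructure F M) (n : ℕ) {x y : M}
    (p : PiecewiseC1Path F x y) : 0 ≤ p.length S n :=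
  Finset.sum_nonneg fun i hi => intervalIntegral.integral_nonneg
    (p.lt i (Finset.mem_range.1 hi)).le fun _ _ => apply_nonneg _ _

/-- A straight line in a chart of the maximal atlas has, in every other chart, the velocity given
by the derivative of the transition map. -/
theorem tendsto_slope_line {F : Type*} [AddCommGroup F] [Module ℝ F] [TopologicalSpace F]
    {M : Type*} [TopologicalSpace M] {e e' : OpenPartialHomeomorph M F} {y v : F} {t : ℝ} {w : F}
    (h : HasDirDeriv (e' ∘ e.symm) (y + t • v) v w) (s : Set ℝ) :
    Tendsto (fun s : ℝ => (s - t)⁻¹ • (e' (e.symm (y + s • v)) - e' (e.symm (y + t • v))))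
      (𝓝[s \ {t}] t) (𝓝 w) := by
  have hs : Tendsto (fun s : ℝ => s - t) (𝓝[s \ {t}] t) (𝓝[≠] 0) := by
    refine tendsto_nhdsWithin_iff.2 ⟨?_, ?_⟩
    · refine tendsto_nhdsWithin_of_tendsto_nhds ?_
      have : Continuous fun s : ℝ => s - t := by fun_prop
      simpa using this.tendsto t
    · filter_upwards [self_mem_nhdsWithin] with s hs
      exact sub_ne_zero.2 hs.2
  refine (h.comp hs).congr fun s => ?_
  simp only [Function.comp]
  rw [add_assoc, ← add_smul, add_sub_cancel]

section Lines

variable {F : Type*} [AddCommGroup F] [Module ℝ F] [TopologicalSpace F] [IsTopologicalAddGroup F]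
  [ContinuousSMul ℝ F] [FirstCountableTopology F]
  {M : Type*} [TopologicalSpace M] [ChartedSpace F M]

theorem isC1Curve_line {e : OpenPartialHomeomorph M F} (he : IsC1Chart e) {y v : F} {u : ℝ}
    (h : ∀ t ∈ Icc 0 u, y + t • v ∈ e.target) :
    IsC1Curve F (fun t : ℝ => e.symm (y + t • v)) 0 u := by
  refine ⟨e.continuousOn_symm.comp (by fun_prop) h, fun e' he' => ?_⟩
  obtain ⟨D, hD, hDc⟩ := (he e' he').1.exists_deriv (e.symm.trans e').open_source
  have hmem : ∀ t ∈ Icc 0 u ∩ (fun t : ℝ => e.symm (y + t • v)) ⁻¹' e'.source,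
      y + t • v ∈ (e.symm.trans e').source := fun t ht => by
    rw [OpenPartialHomeomorph.trans_source]
    exact ⟨h t ht.1, ht.2⟩
  refine ⟨fun t => D (y + t • v) v, fun t ht => ?_, fun t ht =>
    tendsto_slope_line (hD _ (hmem t ht) v) _⟩
  refine ContinuousAt.continuousWithinAt ?_
  have hg : ContinuousAt (fun t : ℝ => (y + t • v, v)) t := by fun_prop
  exact ContinuousAt.comp (f := fun t : ℝ => (y + t • v, v)) (hDc _ (hmem t ht) v) hg

variable [T2Space F]

theorem velocity_line {e : OpenPartialHomeomorph M F} (he : IsC1Chart e) {y v : F} {u t : ℝ}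
    (hu : 0 < u) (ht : t ∈ Icc 0 u) (h : y + t • v ∈ e.target) :
    velocity F (fun t : ℝ => e.symm (y + t • v)) 0 u t =
      fromChart e (e.symm (y + t • v)) v := by
  have hmem : y + t • v ∈ (e.symm.trans (chartAt F (e.symm (y + t • v)))).source := by
    rw [OpenPartialHomeomorph.trans_source]
    exact ⟨h, mem_chart_source F _⟩
  obtain ⟨D, hD, -⟩ := (he _ (chart_mem_atlas F (e.symm (y + t • v)))).1.exists_deriv
    (e.symm.trans _).open_source
  have hd := hD _ hmem v
  have hne : (𝓝[Icc 0 u \ {t}] t).NeBot := by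
    have := (uniqueDiffOn_Icc hu t ht).accPt
    rwa [accPt_principal_iff_nhdsWithin] at this
  rw [fromChart, e.right_inv h, hd.dirDeriv_eq]
  exact (tendsto_slope_line hd _).limUnder_eq

/-- The straight line from `y` to `y + u v` in a chart, as a path with a single `C¹` piece. -/
def linePath {e : OpenPartialHomeomorph M F} (he : IsC1Chart e) {y v : F} {u : ℝ} (hu : 0 < u)
    (h : ∀ t ∈ Icc 0 u, y + t • v ∈ e.target) :
    PiecewiseC1Path F (e.symm y) (e.symm (y + u • v)) where
  γ t := e.symm (y + t • v)
  m := 1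
  τ i := i * u
  lt i hi := by
    obtain rfl : i = 0 := by omega
    simpa using hu
  c1 i hi := by
    obtain rfl : i = 0 := by omega
    simpa using isC1Curve_line he h
  source := by simp
  target := by simp

theorem FinslerStructure.length_linePath_le (S : FinslerStructure F M)
    {e : OpenPartialHomeomorph M F} (he : IsC1Chart e) {y v : F} {u : ℝ} (hu : 0 < u)
    (h : ∀ t ∈ Icc 0 u, y + t • v ∈ e.target) (n : ℕ)
    (hN : ∀ t ∈ Icc 0 u, S.N n (e.symm (y + t • v)) (fromChart e (e.symm (y + t • v)) v) ≤ 1) :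
    (linePath he hu h).length S n ≤ u := by
  have key : ‖∫ t in (0 : ℝ)..u, S.N n (e.symm (y + t • v))
      (velocity F (fun t : ℝ => e.symm (y + t • v)) 0 u t)‖ ≤ 1 * |u - 0| := by
    refine intervalIntegral.norm_integral_le_of_norm_le_const fun t ht => ?_
    rw [uIoc_of_le hu.le] at ht
    have ht' := Ioc_subset_Icc_self ht
    rw [velocity_line he hu ht' (h t ht'), Real.norm_of_nonneg (apply_nonneg _ _)]
    exact hN t ht'
  rw [sub_zero, abs_of_pos hu, one_mul] at key
  refine le_trans (le_of_eq ?_) ((le_abs_self _).trans key)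
  simp [PiecewiseC1Path.length, linePath]

/-- Moving for the time `u` along a straight line whose velocity has all seminorms at most `1`
changes the Finsler distance by at most `u`: every component distance is at most `u`, and
`s / (1 + s) ≤ s`. -/
theorem FinslerStructure.finslerDist_line_le (S : FinslerStructure F M)
    {e : OpenPartialHomeomorph M F} (he : IsC1Chart e) {y v : F} {u : ℝ} (hu : 0 < u)
    (h : ∀ t ∈ Icc 0 u, y + t • v ∈ e.target)
    (hN : ∀ n, ∀ t ∈ Icc 0 u,
      S.N n (e.symm (y + t • v)) (fromChart e (e.symm (y + t • v)) v) ≤ 1) :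
    S.finslerDist (e.symm y) (e.symm (y + u • v)) ≤ u := by
  have h0 : ∀ n, 0 ≤ S.compDist n (e.symm y) (e.symm (y + u • v)) := fun n =>
    Real.iInf_nonneg fun p => S.length_nonneg n p
  have h1 : ∀ n, S.compDist n (e.symm y) (e.symm (y + u • v)) ≤ u := fun n =>
    (ciInf_le ⟨0, by rintro _ ⟨p, rfl⟩; exact S.length_nonneg n p⟩ (linePath he hu h)).trans
      (S.length_linePath_le he hu h n (hN n))
  have hsum : HasSum (fun n : ℕ => (1 / 2 : ℝ) ^ (n + 1) * u) u := by
    have := (hasSum_geometric_two.mul_left (1 / 2 : ℝ)).mul_right u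
    norm_num at this
    simpa only [pow_succ', one_div, inv_pow] using this
  refine Real.tsum_le_of_sum_le (fun n => ?_) (fun s => ?_)
  · have := h0 n
    positivity
  · refine le_trans (Finset.sum_le_sum fun n _ => ?_)
      (sum_le_hasSum s (fun n _ => by positivity) hsum)
    refine mul_le_mul_of_nonneg_left ?_ (by positivity)
    exact (div_le_self (h0 n) (by linarith [h0 n])).trans (h1 n)

end Lines

/-! ### Local descent -/

/-- The weak slope of `φ` at `x` is at least `σ` (in the sense of Degiovanni and Marzocchi): on a
ball around `x` there is a continuous local deformation that moves points with speed at most `1`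
and lowers `φ` at the rate `σ`. -/
def DescendsAt {M : Type*} [PseudoMetricSpace M] (φ : M → ℝ) (σ : ℝ) (x : M) : Prop :=
  ∃ r > 0, ∃ H : M → ℝ → M, (∀ w, H w 0 = w) ∧
    ContinuousOn (fun p : M × ℝ => H p.1 p.2) (Metric.ball x r ×ˢ Icc 0 r) ∧
    ∀ w ∈ Metric.ball x r, ∀ u ∈ Icc 0 r, dist (H w u) w ≤ u ∧ φ (H w u) ≤ φ w - σ * u

/-- As `DescendsAt`, but without any control of the distance by which points move. -/
def DescendsTopologicallyAt {M : Type*} [PseudoMetricSpace M] (φ : M → ℝ) (σ : ℝ) (x : M) : Prop :=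
  ∃ r > 0, ∃ H : M → ℝ → M, (∀ w, H w 0 = w) ∧
    ContinuousOn (fun p : M × ℝ => H p.1 p.2) (Metric.ball x r ×ˢ Icc 0 r) ∧
    ∀ w ∈ Metric.ball x r, ∀ u ∈ Icc 0 r, φ (H w u) ≤ φ w - σ * u

/-- The motion along the lines of direction `v` in the chart `e`. At time `0` it is the identity,
also outside the domain of `e`. -/
noncomputable def lineFlow {F : Type*} [AddCommGroup F] [Module ℝ F] [TopologicalSpace F]
    {M : Type*} [TopologicalSpace M] (e : OpenPartialHomeomorph M F) (v : F) (w : M) (u : ℝ) : M :=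
  if u = 0 then w else e.symm (e w + u • v)

theorem lineFlow_zero {F : Type*} [AddCommGroup F] [Module ℝ F] [TopologicalSpace F]
    {M : Type*} [TopologicalSpace M] (e : OpenPartialHomeomorph M F) (v : F)
    (w : M) : lineFlow e v w 0 = w :=
  if_pos rfl

theorem lineFlow_eq {F : Type*} [AddCommGroup F] [Module ℝ F] [TopologicalSpace F]
    {M : Type*} [TopologicalSpace M] {e : OpenPartialHomeomorph M F} {w : M} (hw : w ∈ e.source)
    (v : F) (u : ℝ) : lineFlow e v w u = e.symm (e w + u • v) := by
  rcases eq_or_ne u 0 with rfl | hu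
  · rw [lineFlow_zero, zero_smul, add_zero, e.left_inv hw]
  · exact if_neg hu

section Descent

variable {F : Type*} [AddCommGroup F] [Module ℝ F] [TopologicalSpace F] [IsTopologicalAddGroup F]
  [ContinuousSMul ℝ F]

/-- If the derivative of `φ` in the direction `v` is at most `-σ` near `x` in a chart, then `φ`
decreases at the rate `σ` along the lines of direction `v`. -/
theorem exists_lineFlow_descent {M : Type*} [PseudoMetricSpace M]
    {e : OpenPartialHomeomorph M F} {x : M} (hx : x ∈ e.source) (v : F) {φ : M → ℝ} {V : Set F}
    (hV : V ∈ 𝓝 (e x)) (hVe : V ⊆ e.target) {d : F → ℝ} {σ : ℝ}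
    (hd : ∀ y ∈ V, HasDirDeriv (φ ∘ e.symm) y v (d y)) (hσ : ∀ y ∈ V, d y ≤ -σ) :
    ∃ r > 0, (∀ w ∈ Metric.ball x r, w ∈ e.source ∧ ∀ u ∈ Icc 0 r, e w + u • v ∈ V) ∧
      ContinuousOn (fun p : M × ℝ => lineFlow e v p.1 p.2) (Metric.ball x r ×ˢ Icc 0 r) ∧
      ∀ w ∈ Metric.ball x r, ∀ u ∈ Icc 0 r, φ (lineFlow e v w u) ≤ φ w - σ * u := by
  have hc : ContinuousAt (fun p : M × ℝ => e p.1 + p.2 • v) (x, 0) := by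
    have h1 : ContinuousAt (fun p : M × ℝ => e p.1) (x, 0) :=
      ContinuousAt.comp (f := fun p : M × ℝ => p.1) (e.continuousAt hx) continuousAt_fst
    exact h1.add (by fun_prop)
  have h1 : ∀ᶠ p : M × ℝ in 𝓝 (x, 0), p.1 ∈ e.source ∧ e p.1 + p.2 • v ∈ V :=
    (continuousAt_fst.eventually_mem (e.open_source.mem_nhds hx)).and
      (hc.eventually_mem (by simpa using hV))
  obtain ⟨r, hr, hball⟩ := Metric.eventually_nhds_iff_ball.1 h1
  have hmem : ∀ w ∈ Metric.ball x (r / 2), ∀ u ∈ Icc 0 (r / 2), w ∈ e.source ∧ e w + u • v ∈ V := by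
    intro w hw u hu
    refine hball (w, u) ?_
    rw [← ball_prod_same]
    refine ⟨Metric.ball_subset_ball (by linarith) hw, ?_⟩
    rw [Metric.mem_ball, Real.dist_0_eq_abs, abs_of_nonneg hu.1]
    linarith [hu.2]
  have hr2 : (0 : ℝ) ∈ Icc 0 (r / 2) := ⟨le_rfl, by linarith⟩
  refine ⟨r / 2, half_pos hr, fun w hw => ⟨(hmem w hw 0 hr2).1, fun u hu => (hmem w hw u hu).2⟩,
    ?_, fun w hw u hu => ?_⟩
  · refine ContinuousOn.congr (f := fun p : M × ℝ => e.symm (e p.1 + p.2 • v)) ?_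
      fun p hp => lineFlow_eq (hmem p.1 hp.1 p.2 hp.2).1 v p.2
    refine e.continuousOn_symm.comp ?_ fun p hp => hVe (hmem p.1 hp.1 p.2 hp.2).2
    refine ContinuousOn.add ?_ (by fun_prop)
    exact e.continuousOn.comp continuousOn_fst fun p hp => (hmem p.1 hp.1 p.2 hp.2).1
  · rcases hu.1.eq_or_lt with rfl | hu0
    · simp [lineFlow_zero]
    have hws := (hmem w hw 0 hr2).1
    have hder : ∀ s ∈ Icc 0 u, HasDerivAt (fun s : ℝ => (φ ∘ e.symm) (e w + s • v))
        (d (e w + s • v)) s := fun s hs =>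
      (hd _ (hmem w hw s ⟨hs.1, hs.2.trans hu.2⟩).2).hasDerivAt
    obtain ⟨ξ, hξ, hξ'⟩ := exists_hasDerivAt_eq_slope _ _ hu0
      (fun s hs => (hder s hs).continuousAt.continuousWithinAt)
      (fun s hs => hder s (Ioo_subset_Icc_self hs))
    have hle := hσ _ (hmem w hw ξ ⟨hξ.1.le, hξ.2.le.trans hu.2⟩).2
    rw [hξ', sub_zero, div_le_iff₀ hu0] at hle
    rw [lineFlow_eq hws]
    simp only [Function.comp, zero_smul, add_zero, e.left_inv hws] at hle
    linarith

end Descent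

/-- At a point that is not critical, `φ` decreases along the lines of some direction in a chart.
This direction need not be admissible for `Φ_φ`, whence the lack of distance control. -/
theorem descendsTopologicallyAt_of_not_isCriticalPt {F : Type*} [AddCommGroup F]
    [Module ℝ F] [TopologicalSpace F] [IsTopologicalAddGroup F] [ContinuousSMul ℝ F]
    [FirstCountableTopology F] {M : Type*} [MetricSpace M] [ChartedSpace F M] {φ : M → ℝ}
    (hφ : IsC1Functional F φ) {x : M} (hx : ¬ IsCriticalPt F φ x) :
    ∃ σ > 0, DescendsTopologicallyAt φ σ x := by
  set e := chartAt F x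
  have hxe : x ∈ e.source := mem_chart_source F x
  obtain ⟨D, hD, hDc⟩ := (hφ e (chart_mem_atlas F x)).exists_deriv e.open_target
  have hex := e.map_source hxe
  obtain ⟨v, hv⟩ : ∃ v, D (e x) v < 0 := by
    by_contra! hcon
    refine hx ⟨e, chart_mem_atlas F x, hxe, fun h => ?_⟩
    have h1 := hcon h
    have h2 := hcon (-h)
    rw [map_neg] at h2
    have : D (e x) h = 0 := by linarith
    rw [← this]
    exact hD _ hex h
  have hc : ContinuousAt (fun y => D y v) (e x) :=
    ContinuousAt.comp (f := fun y : F => (y, v)) (g := fun p : F × F => D p.1 p.2)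
      (hDc _ hex v) (by fun_prop)
  have hV : ∀ᶠ y in 𝓝 (e x), y ∈ e.target ∧ D y v < -(-(D (e x) v) / 2) :=
    (e.open_target.eventually_mem hex).and
      (hc.eventually_lt continuousAt_const (by linarith))
  obtain ⟨r, hr, -, hcont, hdesc⟩ := exists_lineFlow_descent hxe v hV
    (fun y hy => hy.1) (fun y hy => hD y hy.1 v) (fun y hy => hy.2.le)
  exact ⟨-(D (e x) v) / 2, by linarith, r, hr, lineFlow e v, lineFlow_zero e v, hcont, hdesc⟩

section FinslerDescent

variable {F : Type*} [AddCommGroup F] [Module ℝ F] [TopologicalSpace F] [IsTopologicalAddGroup F]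
  [ContinuousSMul ℝ F] [LocallyConvexSpace ℝ F] [T2Space F] [FirstCountableTopology F]
  {M : Type*} [MetricSpace M] [ChartedSpace F M]

/-- If `Φ_φ(x) < -δ`, then `φ` descends at `x` with the rate `δ / 2`. The coordinates `v` in the
bundle chart of half of an admissible direction at `x` have all seminorms at most `1` also at the
nearby points, since the comparison of the seminorms is uniform in their index. -/
theorem FinslerStructure.descendsAt_of_Phi_lt (S : FinslerStructure F M)
    (hS : ∀ x y : M, dist x y = S.finslerDist x y) {φ : M → ℝ} (hφ : IsC1Functional F φ) {x : M}
    {δ : ℝ} (h : S.Phi φ x < -δ) : DescendsAt φ (δ / 2) x := by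
  have hne : (tangentDeriv F φ x '' S.unitBall x).Nonempty :=
    ⟨_, 0, fun n => by simp, rfl⟩
  obtain ⟨_, ⟨h₀, hh₀, rfl⟩, hlt⟩ := exists_lt_of_csInf_lt hne h
  obtain ⟨e, he, O, hO, hxO, hOe, -, hcomp⟩ := S.bundleChart x
  obtain ⟨W, hW, hWk⟩ := hcomp 2 one_lt_two x hxO
  set e' := chartAt F x with he'
  have hxe : x ∈ e.source := hOe hxO
  have hxe' : x ∈ e'.source := mem_chart_source F x
  obtain ⟨Df, hDf, hDfc⟩ := (hφ e' (chart_mem_atlas F x)).exists_deriv e'.open_target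
  obtain ⟨T, hT, hTc⟩ := (he e' (chart_mem_atlas F x)).1.exists_deriv (e.symm.trans e').open_source
  obtain ⟨T', hT', -⟩ := (he e' (chart_mem_atlas F x)).2.exists_deriv (e'.symm.trans e).open_source
  have hsrc : ∀ {y : F}, y ∈ (e.symm.trans e').source ↔ y ∈ e.target ∧ e.symm y ∈ e'.source := by
    intro y
    rw [OpenPartialHomeomorph.trans_source]
    rfl
  have hex : e x ∈ (e.symm.trans e').source :=
    hsrc.2 ⟨e.map_source hxe, by rwa [e.left_inv hxe]⟩
  have hex' : e' x ∈ (e'.symm.trans e).source := by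
    rw [OpenPartialHomeomorph.trans_source]
    exact ⟨e'.map_source hxe', by rwa [mem_preimage, e'.left_inv hxe']⟩
  set w₀ := T' (e' x) h₀ with hw₀
  have hinv : T (e x) w₀ = h₀ := by
    have hgx : (e ∘ e'.symm) (e' x) = e x := by simp [e'.left_inv hxe']
    have := deriv_deriv_inverse (f := e' ∘ e.symm) (g := e ∘ e'.symm)
      (e.symm.trans e').open_source hT (hT' _ hex' h₀) (by rwa [hgx])
      (by rw [hgx]; exact hTc _ hex _) (by
        filter_upwards [(e'.symm.trans e).open_source.mem_nhds hex'] with z hz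
        rw [OpenPartialHomeomorph.trans_source] at hz
        simp only [Function.comp]
        rw [e.left_inv hz.2]
        exact e'.right_inv hz.1)
    rwa [hgx] at this
  set v : F := (1 / 2 : ℝ) • w₀ with hv
  have hTv : T (e x) v = (1 / 2 : ℝ) • h₀ := by rw [hv, map_smul, hinv]
  set d : F → ℝ := fun y => Df (e' (e.symm y)) (T y v) with hd
  have hder : ∀ y ∈ (e.symm.trans e').source, HasDirDeriv (φ ∘ e.symm) y v (d y) := by
    intro y hy
    have hy' := hsrc.1 hy
    have hline : Tendsto (fun t : ℝ => y + t • v) (𝓝[≠] 0) (𝓝 y) := by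
      refine tendsto_nhdsWithin_of_tendsto_nhds ?_
      have : Continuous fun t : ℝ => y + t • v := by fun_prop
      simpa using this.tendsto 0
    have := tendsto_slope_comp (f := φ ∘ e'.symm) (c := fun t : ℝ => e' (e.symm (y + t • v)))
      (y := T y v) e'.open_target hDf (by simpa using e'.map_source hy'.2)
      (by simpa using hDfc _ (e'.map_source hy'.2) _)
      (by simp only [zero_smul, add_zero]; exact hT y hy v)
    simp only [zero_smul, add_zero] at this
    refine this.congr' ?_
    filter_upwards [hline.eventually_mem ((e.symm.trans e').open_source.mem_nhds hy)] with t ht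
    have ht' := hsrc.1 ht
    simp only [Function.comp]
    rw [e'.left_inv ht'.2, e'.left_inv hy'.2]
  have hdx : d (e x) < -(δ / 2) := by
    have : tangentDeriv F φ x h₀ = Df (e' x) h₀ := (hDf _ (e'.map_source hxe') h₀).limUnder_eq
    rw [this] at hlt
    simp only [hd]
    rw [e.left_inv hxe, hTv, map_smul, smul_eq_mul]
    linarith
  have hdc : ContinuousAt d (e x) := by
    have h1 : ContinuousAt (fun y => e' (e.symm y)) (e x) :=
      ContinuousAt.comp (g := e') (e'.continuousAt (by rwa [e.left_inv hxe]))
        (e.symm.continuousAt (e.map_source hxe))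
    have h2 : ContinuousAt (fun y => T y v) (e x) :=
      ContinuousAt.comp (f := fun y : F => (y, v)) (g := fun p : F × F => T p.1 p.2)
        (hTc _ hex v) (by fun_prop)
    exact ContinuousAt.comp (f := fun y : F => (e' (e.symm y), T y v))
      (g := fun p : F × F => Df p.1 p.2)
      (hDfc _ (e'.map_source (by rwa [e.left_inv hxe])) _) (h1.prodMk h2)
  have hfrom : fromChart e x v = (1 / 2 : ℝ) • h₀ := by
    rw [fromChart, (hT _ hex v).dirDeriv_eq, hTv]
  have hV : ∀ᶠ y in 𝓝 (e x), y ∈ (e.symm.trans e').source ∧ d y < -(δ / 2) ∧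
      e.symm y ∈ W ∩ O := by
    refine ((e.symm.trans e').open_source.eventually_mem hex).and
      ((hdc.eventually_lt continuousAt_const hdx).and ?_)
    refine (e.symm.continuousAt (e.map_source hxe)).eventually_mem ?_
    rw [e.left_inv hxe]
    exact inter_mem hW (hO.mem_nhds hxO)
  obtain ⟨r, hr, hmem, hcont, hdesc⟩ := exists_lineFlow_descent hxe v hV
    (fun y hy => (hsrc.1 hy.1).1) (fun y hy => hder y hy.1) (fun y hy => hy.2.1.le)
  refine ⟨r, hr, lineFlow e v, lineFlow_zero e v, hcont, fun w hw u hu =>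
    ⟨?_, hdesc w hw u hu⟩⟩
  rcases hu.1.eq_or_lt with rfl | hu0
  · simp [lineFlow_zero]
  obtain ⟨hws, hwV⟩ := hmem w hw
  have hwV' : ∀ t ∈ Icc 0 u, e w + t • v ∈ _ := fun t ht => hwV t ⟨ht.1, ht.2.trans hu.2⟩
  have := S.finslerDist_line_le he hu0 (fun t ht => (hsrc.1 (hwV' t ht).1).1) (fun n t ht => by
    have h1 := (hWk _ (hwV' t ht).2.2 n v).2
    have h2 : S.N n x (fromChart e x v) ≤ 1 / 2 := by
      rw [hfrom, map_smul_eq_mul, Real.norm_of_nonneg (by norm_num)]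
      linarith [hh₀ n]
    linarith)
  rw [dist_comm, lineFlow_eq hws, hS]
  rwa [e.left_inv hws] at this

end FinslerDescent

/-! ### Ekeland's variational principle -/

/-- Ekeland's variational principle on a closed subset of a complete metric space: the limit of a
sequence of almost optimal choices in the shrinking sets `{y | J y + κ d(y, x) ≤ J x}`. -/
theorem exists_ekeland {X : Type*} [MetricSpace X] [CompleteSpace X] {J : X → ℝ}
    (hJ : LowerSemicontinuous J) {K : Set X} (hK : IsClosed K) {c : ℝ} (hc : ∀ x ∈ K, c ≤ J x)
    {κ : ℝ} (hκ : 0 < κ) {x₀ : X} (hx₀ : x₀ ∈ K) :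
    ∃ x ∈ K, J x + κ * dist x x₀ ≤ J x₀ ∧ ∀ y ∈ K, J y + κ * dist y x ≤ J x → y = x := by
  let S : X → Set X := fun x => {y | y ∈ K ∧ J y + κ * dist y x ≤ J x}
  have hSself : ∀ x ∈ K, x ∈ S x := fun x hx => ⟨hx, by simp⟩
  have hStrans : ∀ {x y z : X}, y ∈ S x → z ∈ S y → z ∈ S x := by
    rintro x y z ⟨-, hy⟩ ⟨hz, hz'⟩
    refine ⟨hz, ?_⟩
    have := mul_le_mul_of_nonneg_left (dist_triangle z y x) hκ.le
    linarith
  have hSclosed : ∀ x, IsClosed (S x) := fun x =>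
    hK.inter ((hJ.add (by fun_prop : Continuous fun y => κ * dist y x).lowerSemicontinuous
      ).isClosed_preimage (J x))
  have hstep : ∀ (n : ℕ) (x : K), ∃ y : K, (y : X) ∈ S x ∧
      ∀ z ∈ S x, J y ≤ J z + (1 / 2) ^ n := by
    intro n x
    have hne : (J '' S x).Nonempty := ⟨_, x, hSself x x.2, rfl⟩
    have hbdd : BddBelow (J '' S x) := ⟨c, by rintro _ ⟨y, hy, rfl⟩; exact hc y hy.1⟩
    obtain ⟨_, ⟨y, hy, rfl⟩, hlt⟩ := exists_lt_of_csInf_lt hne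
      (lt_add_of_pos_right (sInf (J '' S x)) (by positivity : (0 : ℝ) < (1 / 2) ^ n))
    exact ⟨⟨y, hy.1⟩, hy, fun z hz => hlt.le.trans
      (add_le_add_left (csInf_le hbdd ⟨z, hz, rfl⟩) _)⟩
  choose f hfS hfle using hstep
  let u : ℕ → K := fun n => Nat.rec ⟨x₀, hx₀⟩ (fun n x => f n x) n
  have hu : ∀ n, u (n + 1) = f n (u n) := fun n => rfl
  have huS : ∀ n, (u (n + 1)).1 ∈ S (u n).1 := fun n => hfS n (u n)
  have hmono : ∀ n k, (u (n + k)).1 ∈ S (u n).1 := by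
    intro n k
    induction k with
    | zero => exact hSself _ (u n).2
    | succ k ih => exact hStrans ih (huS (n + k))
  have hdist : ∀ n, ∀ z ∈ S (u (n + 1)).1, dist z (u (n + 1)) ≤ (1 / κ) * (1 / 2) ^ n := by
    intro n z hz
    have h1 : J (u (n + 1)) ≤ J z + (1 / 2) ^ n := by
      rw [hu]
      exact hfle n _ z (hStrans (huS n) hz)
    rw [one_div_mul_eq_div, le_div_iff₀ hκ]
    linarith [hz.2, mul_comm κ (dist z (u (n + 1)))]
  have hcau : CauchySeq fun n => (u (n + 1)).1 := by
    refine cauchySeq_of_le_geometric (1 / 2) (1 / κ) (by norm_num) fun n => ?_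
    rw [dist_comm]
    exact hdist n _ (huS (n + 1))
  obtain ⟨x, hx⟩ := cauchySeq_tendsto_of_complete hcau
  have hx' : Tendsto (fun n => (u n).1) atTop (𝓝 x) :=
    (tendsto_add_atTop_iff_nat (f := fun n => (u n).1) 1).1 hx
  have hxS : ∀ n, x ∈ S (u n).1 := fun n =>
    (hSclosed _).mem_of_tendsto ((tendsto_add_atTop_iff_nat (f := fun n => (u n).1) n).2 hx')
      (Eventually.of_forall fun k => by rw [add_comm]; exact hmono n k)
  refine ⟨x, (hxS 0).1, (hxS 0).2, fun y hy hyx => ?_⟩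
  have hlim : Tendsto (fun n => (u (n + 1)).1) atTop (𝓝 y) := by
    rw [tendsto_iff_dist_tendsto_zero]
    refine squeeze_zero (fun _ => dist_nonneg) (fun n => ?_)
      (by simpa using (tendsto_pow_atTop_nhds_zero_of_lt_one (r := (1 / 2 : ℝ)) (by norm_num)
        (by norm_num)).const_mul (1 / κ))
    rw [dist_comm]
    simpa using hdist n y (hStrans (hxS (n + 1)) ⟨hy, hyx⟩)
  exact tendsto_nhds_unique hlim hx

/-! ### Local deformations applied to continuous families -/

/-- A deformation that is only continuous on `O × [0, r]` can be applied to a continuous family `g`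
for the continuous times `m`, provided that `m` vanishes off a closed set that `g` maps to `O`. -/
theorem continuous_deform {M X : Type*} [TopologicalSpace M] [TopologicalSpace X]
    {H : M → ℝ → M} (hH : ∀ w, H w 0 = w) {O : Set M} {r : ℝ}
    (hc : ContinuousOn (fun p : M × ℝ => H p.1 p.2) (O ×ˢ Icc 0 r)) (hO : IsOpen O)
    {g : X → M} (hg : Continuous g) {m : X → ℝ} (hm : Continuous m) (hmr : ∀ x, m x ∈ Icc 0 r)
    {C : Set X} (hC : IsClosed C) (hCO : ∀ x ∈ C, g x ∈ O) (hmC : ∀ x ∉ C, m x = 0) :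
    Continuous fun x => H (g x) (m x) := by
  refine continuous_iff_continuousAt.2 fun x => ?_
  by_cases hx : x ∈ C
  · have hev : ∀ᶠ y in 𝓝 x, (g y, m y) ∈ O ×ˢ Icc 0 r := by
      filter_upwards [hg.continuousAt.eventually_mem (hO.mem_nhds (hCO x hx))] with y hy
      exact ⟨hy, hmr y⟩
    exact (hc (g x, m x) ⟨hCO x hx, hmr x⟩).tendsto.comp
      (tendsto_nhdsWithin_iff.2 ⟨(hg.prodMk hm).tendsto x, hev⟩)
  · refine hg.continuousAt.congr ?_
    filter_upwards [hC.isOpen_compl.mem_nhds hx] with y hy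
    rw [hmC y hy, hH]

theorem DescendsAt.mono {M : Type*} [PseudoMetricSpace M] {φ : M → ℝ} {σ σ' : ℝ} {x : M}
    (h : DescendsAt φ σ x) (hσ : σ' ≤ σ) : DescendsAt φ σ' x := by
  obtain ⟨r, hr, H, h0, hc, hH⟩ := h
  refine ⟨r, hr, H, h0, hc, fun w hw u hu => ⟨(hH w hw u hu).1, (hH w hw u hu).2.trans ?_⟩⟩
  linarith [mul_le_mul_of_nonneg_right hσ hu.1]

theorem DescendsAt.eventually {M : Type*} [PseudoMetricSpace M] {φ : M → ℝ} {σ : ℝ} {x : M}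
    (h : DescendsAt φ σ x) : ∀ᶠ y in 𝓝 x, DescendsAt φ σ y := by
  obtain ⟨r, hr, H, h0, hc, hH⟩ := h
  filter_upwards [Metric.ball_mem_nhds x (half_pos hr)] with y hy
  have hsub : Metric.ball y (r / 2) ⊆ Metric.ball x r :=
    Metric.ball_subset_ball' (by linarith [Metric.mem_ball.1 hy])
  have hsub' : Icc 0 (r / 2) ⊆ Icc 0 r := Icc_subset_Icc_right (by linarith)
  exact ⟨r / 2, half_pos hr, H, h0, hc.mono (prod_mono hsub hsub'),
    fun w hw u hu => hH w (hsub hw) u (hsub' hu)⟩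

section Family

variable {M : Type*} [PseudoMetricSpace M] {X : Type*} [PseudoMetricSpace X]

/-- The family `g'` arises from `g` by motions with speed at most `1` that lower `φ` at the rate
`σ`; the time of motion `τ` is at most `s` and vanishes on `Z`. -/
structure IsDescent (φ : M → ℝ) (σ : ℝ) (Z : Set X) (s : ℝ) (g g' : C(X, M)) (τ : C(X, ℝ)) :
    Prop where
  nonneg : ∀ t, 0 ≤ τ t
  le : ∀ t, τ t ≤ s
  eq_zero : ∀ t ∈ Z, τ t = 0
  dist_le : ∀ t, dist (g' t) (g t) ≤ τ t
  apply_le : ∀ t, φ (g' t) ≤ φ (g t) - σ * τ t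

/-- Prolonging a descent near one parameter. The additional time `max (s θ - τ) 0`, where `θ` is a
bump function, brings the total time to `max τ (s θ)`, which never exceeds `s`. -/
theorem exists_prolongation_nhds {φ : M → ℝ} {σ : ℝ} {Z : Set X} (hZ : IsClosed Z)
    (g : C(X, M)) {t₀ : X} (ht₀ : t₀ ∉ Z) (h : DescendsAt φ σ (g t₀)) :
    ∃ V ∈ 𝓝 t₀, ∃ s₁ > 0, ∀ s, 0 < s → s ≤ s₁ → ∀ g' τ, IsDescent φ σ Z s g g' τ →
      ∃ g'' τ', IsDescent φ σ Z s g g'' τ' ∧ (∀ t, τ t ≤ τ' t) ∧ ∀ t ∈ V, τ' t = s := by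
  obtain ⟨r, hr, H, h0, hc, hH⟩ := h
  have hnhds : ∀ᶠ t in 𝓝 t₀, g t ∈ Metric.ball (g t₀) (r / 2) ∧ t ∈ Zᶜ :=
    (g.continuous.continuousAt.eventually_mem (Metric.ball_mem_nhds _ (half_pos hr))).and
      (hZ.isOpen_compl.eventually_mem ht₀)
  obtain ⟨ρ, hρ, hball⟩ := Metric.eventually_nhds_iff_ball.1 hnhds
  refine ⟨Metric.closedBall t₀ (ρ / 3), Metric.closedBall_mem_nhds _ (by positivity), r / 2,
    half_pos hr, fun s hs hsr g' τ hg' => ?_⟩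
  let θ : X → ℝ := fun t => max 0 (min 1 (2 - 3 * dist t t₀ / ρ))
  have hθ0 : ∀ t, 0 ≤ θ t := fun t => le_max_left _ _
  have hθ1 : ∀ t, θ t ≤ 1 := fun t => max_le zero_le_one (min_le_left _ _)
  have hθin : ∀ t ∈ Metric.closedBall t₀ (ρ / 3), θ t = 1 := fun t ht => by
    have : 3 * dist t t₀ / ρ ≤ 1 := by
      rw [div_le_one hρ]
      linarith [Metric.mem_closedBall.1 ht]
    simp only [θ]
    rw [min_eq_left (by linarith), max_eq_right zero_le_one]
  have hθout : ∀ t ∉ Metric.closedBall t₀ (2 * ρ / 3), θ t = 0 := fun t ht => by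
    have : 2 ≤ 3 * dist t t₀ / ρ := by
      rw [le_div_iff₀ hρ]
      linarith [not_le.1 (mt Metric.mem_closedBall.2 ht)]
    exact max_eq_left ((min_le_right _ _).trans (by linarith))
  have hθc : Continuous θ := by fun_prop
  have hin : ∀ t ∈ Metric.closedBall t₀ (2 * ρ / 3),
      g t ∈ Metric.ball (g t₀) (r / 2) ∧ t ∈ Zᶜ := fun t ht =>
    hball t (Metric.closedBall_subset_ball (by linarith) ht)
  let m : X → ℝ := fun t => max (s * θ t - τ t) 0
  have hmc : Continuous m := by fun_prop
  have hm0 : ∀ t, 0 ≤ m t := fun t => le_max_right _ _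
  have hmout : ∀ t ∉ Metric.closedBall t₀ (2 * ρ / 3), m t = 0 := fun t ht =>
    max_eq_right (by rw [hθout t ht]; linarith [hg'.nonneg t])
  have hsθ : ∀ t, s * θ t ≤ s := fun t => mul_le_of_le_one_right hs.le (hθ1 t)
  have hms : ∀ t, τ t + m t ≤ s := fun t => by
    rcases max_cases (s * θ t - τ t) 0 with ⟨h1, -⟩ | ⟨h1, -⟩
    · linarith [hsθ t]
    · linarith [hg'.le t]
  have hmr : ∀ t, m t ∈ Icc 0 r := fun t =>
    ⟨hm0 t, by linarith [hms t, hg'.nonneg t]⟩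
  have hin' : ∀ t ∈ Metric.closedBall t₀ (2 * ρ / 3), g' t ∈ Metric.ball (g t₀) r := fun t ht => by
    have h1 := Metric.mem_ball.1 (hin t ht).1
    have h2 := dist_triangle (g' t) (g t) (g t₀)
    rw [Metric.mem_ball]
    linarith [hg'.dist_le t, hg'.le t]
  have hstep : ∀ t, dist (H (g' t) (m t)) (g' t) ≤ m t ∧
      φ (H (g' t) (m t)) ≤ φ (g' t) - σ * m t := fun t => by
    by_cases ht : t ∈ Metric.closedBall t₀ (2 * ρ / 3)
    · exact hH _ (hin' t ht) _ (hmr t)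
    · simp [hmout t ht, h0]
  refine ⟨⟨fun t => H (g' t) (m t), continuous_deform h0 hc Metric.isOpen_ball g'.continuous hmc
    hmr Metric.isClosed_closedBall hin' hmout⟩, ⟨fun t => τ t + m t, by fun_prop⟩,
    ⟨fun t => add_nonneg (hg'.nonneg t) (hm0 t), hms, fun t ht => ?_, fun t => ?_, fun t => ?_⟩,
    fun t => le_add_of_nonneg_right (hm0 t), fun t ht => ?_⟩
  · have : m t = 0 := hmout t fun ht' => (hin t ht').2 ht
    simp [this, hg'.eq_zero t ht]
  · refine (dist_triangle _ (g' t) _).trans ?_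
    simp only [ContinuousMap.coe_mk]
    linarith [hg'.dist_le t, (hstep t).1]
  · simp only [ContinuousMap.coe_mk]
    linarith [hg'.apply_le t, (hstep t).2]
  · simp only [ContinuousMap.coe_mk, m]
    rw [hθin t ht, mul_one, max_eq_left (by linarith [hg'.le t])]
    ring

/-- A family can be deformed so that all parameters in a compact set `T` of points of descent move
for the same small time `s`, and no parameter moves for a longer time. -/
theorem exists_isDescent {φ : M → ℝ} {σ : ℝ} {Z T : Set X} (hZ : IsClosed Z) (hT : IsCompact T)
    (hTZ : Disjoint T Z) (g : C(X, M)) (h : ∀ t ∈ T, DescendsAt φ σ (g t)) :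
    ∃ s₁ > 0, ∀ s, 0 < s → s ≤ s₁ → ∃ g' τ, IsDescent φ σ Z s g g' τ ∧ ∀ t ∈ T, τ t = s := by
  have key : ∃ s₁ > 0, ∀ s, 0 < s → s ≤ s₁ → ∀ g' τ, IsDescent φ σ Z s g g' τ →
      ∃ g'' τ', IsDescent φ σ Z s g g'' τ' ∧ (∀ t, τ t ≤ τ' t) ∧ ∀ t ∈ T, τ' t = s := by
    refine hT.induction_on (p := fun T => ∃ s₁ > 0, ∀ s, 0 < s → s ≤ s₁ → ∀ g' τ,
      IsDescent φ σ Z s g g' τ →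
      ∃ g'' τ', IsDescent φ σ Z s g g'' τ' ∧ (∀ t, τ t ≤ τ' t) ∧ ∀ t ∈ T, τ' t = s) ?_ ?_ ?_ ?_
    · exact ⟨1, one_pos, fun s _ _ g' τ hg' => ⟨g', τ, hg', fun _ => le_rfl, by simp⟩⟩
    · rintro A B hAB ⟨s₁, hs₁, hB⟩
      refine ⟨s₁, hs₁, fun s hs hs' g' τ hg' => ?_⟩
      obtain ⟨g'', τ', h1, h2, h3⟩ := hB s hs hs' g' τ hg'
      exact ⟨g'', τ', h1, h2, fun t ht => h3 t (hAB ht)⟩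
    · rintro A B ⟨s₁, hs₁, hA⟩ ⟨s₂, hs₂, hB⟩
      refine ⟨min s₁ s₂, lt_min hs₁ hs₂, fun s hs hs' g' τ hg' => ?_⟩
      obtain ⟨g₁, τ₁, h1, h2, h3⟩ := hA s hs (hs'.trans (min_le_left _ _)) g' τ hg'
      obtain ⟨g₂, τ₂, k1, k2, k3⟩ := hB s hs (hs'.trans (min_le_right _ _)) g₁ τ₁ h1
      refine ⟨g₂, τ₂, k1, fun t => (h2 t).trans (k2 t), fun t ht => ?_⟩
      rcases ht with ht | ht
      · exact le_antisymm (k1.le t) ((h3 t ht).symm.le.trans (k2 t))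
      · exact k3 t ht
    · intro t ht
      obtain ⟨V, hV, hV'⟩ := exists_prolongation_nhds hZ g (disjoint_left.1 hTZ ht) (h t ht)
      exact ⟨V, mem_nhdsWithin_of_mem_nhds hV, hV'⟩
  obtain ⟨s₁, hs₁, hk⟩ := key
  refine ⟨s₁, hs₁, fun s hs hs' => ?_⟩
  obtain ⟨g', τ, h1, -, h3⟩ := hk s hs hs' g 0 ⟨fun _ => le_rfl, fun _ => hs.le, fun _ _ => rfl,
    fun _ => by simp, fun _ => by simp⟩
  exact ⟨g', τ, h1, h3⟩

end Family

/-! ### The minimax principle relative to a separating set -/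

/-- The closed set `A` separates `x₀` from `x₁`: it contains neither of them, and it meets every
path from `x₀` to `x₁`. Moreover `φ ≥ c` on `A`. -/
structure IsSeparating {M : Type*} [TopologicalSpace M] (φ : M → ℝ) (c : ℝ) (x₀ x₁ : M)
    (A : Set M) : Prop where
  isClosed : IsClosed A
  le : ∀ x ∈ A, c ≤ φ x
  left : x₀ ∉ A
  right : x₁ ∉ A
  meets : ∀ h : Path x₀ x₁, ∃ t, h t ∈ A

section Minimax

variable {M : Type*} [MetricSpace M] {φ : M → ℝ} {c : ℝ} {x₀ x₁ : M} {A : Set M}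

/-- There is no uniform descent near a separating set `A` at the level `c` of the minimax. Otherwise
Ekeland's principle is applied to `J g = sup_t (φ (g t) - b d(g t, A))` on the paths that agree with
an almost optimal path `h₀` outside a neighbourhood of `A`. The penalty keeps the parameters where
the supremum is almost attained near `A`, and moving those parameters lowers `J`. -/
theorem IsSeparating.not_uniform_descent [CompleteSpace M] (hA : IsSeparating φ c x₀ x₁ A)
    (hφ : Continuous φ) (hc : ∀ ε > 0, ∃ h : Path x₀ x₁, ∀ t, φ (h t) ≤ c + ε)
    {σ ε₀ : ℝ} (hσ : 0 < σ) (hε₀ : 0 < ε₀)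
    (h : ∀ x, Metric.infDist x A < ε₀ → |φ x - c| < ε₀ → DescendsAt φ σ x) : False := by
  have hAne : A.Nonempty := by
    obtain ⟨h₁, -⟩ := hc 1 one_pos
    obtain ⟨t, ht⟩ := hA.meets h₁
    exact ⟨_, ht⟩
  -- with `2 * b ≤ σ`, the penalty costs at most half of the descent of `φ`
  obtain ⟨b, hb, hbσ, hb1⟩ : ∃ b : ℝ, 0 < b ∧ 2 * b ≤ σ ∧ 2 * b ≤ 1 :=
    ⟨min σ 1 / 2, by positivity, by linarith [min_le_left σ 1], by linarith [min_le_right σ 1]⟩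
  have hd0 := (hA.isClosed.notMem_iff_infDist_pos hAne).1 hA.left
  have hd1 := (hA.isClosed.notMem_iff_infDist_pos hAne).1 hA.right
  obtain ⟨ε, hε, hεε₀, hεx₀, hεx₁⟩ : ∃ ε : ℝ, 0 < ε ∧ 2 * ε ≤ ε₀ ∧
      ε ≤ Metric.infDist x₀ A ∧ ε ≤ Metric.infDist x₁ A := by
    refine ⟨min (ε₀ / 2) (min (Metric.infDist x₀ A) (Metric.infDist x₁ A)),
      lt_min (by positivity) (lt_min hd0 hd1), ?_,
      (min_le_right _ _).trans (min_le_left _ _), (min_le_right _ _).trans (min_le_right _ _)⟩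
    linarith [min_le_left (ε₀ / 2) (min (Metric.infDist x₀ A) (Metric.infDist x₁ A))]
  have hbε : 0 < b * ε := mul_pos hb hε
  have hbε₀ : 2 * (b * ε₀) ≤ ε₀ := by nlinarith
  have hbε' : 2 * (b * ε) ≤ b * ε₀ := by nlinarith
  obtain ⟨h₀, hh₀⟩ := hc (b * ε / 4) (by positivity)
  let G : M → ℝ := fun x => φ x - b * Metric.infDist x A
  have hG : Continuous G := hφ.sub (continuous_const.mul (Metric.continuous_infDist_pt A))
  let J : C(unitInterval, M) → ℝ := fun g => ⨆ t, G (g t)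
  have hbdd : ∀ g : C(unitInterval, M), BddAbove (range fun t => G (g t)) := fun g =>
    (isCompact_range (hG.comp g.continuous)).bddAbove
  have hGJ : ∀ (g : C(unitInterval, M)) t, G (g t) ≤ J g := fun g t => le_ciSup (hbdd g) t
  have hJ : LowerSemicontinuous J := by
    intro g r hr
    obtain ⟨t, ht⟩ := exists_lt_of_lt_ciSup hr
    have hcont : Continuous fun g : C(unitInterval, M) => G (g t) :=
      hG.comp (ContinuousEvalConst.continuous_eval_const t)
    filter_upwards [hcont.continuousAt.eventually (lt_mem_nhds ht)] with g' hg'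
    exact hg'.trans_le (hGJ g' t)
  let K : Set C(unitInterval, M) := {g | ∀ t, ε ≤ Metric.infDist (h₀ t) A → g t = h₀ t}
  have hK : IsClosed K := by
    simp only [K, ofPred_forall]
    exact isClosed_iInter fun t => isClosed_iInter fun _ =>
      isClosed_eq (ContinuousEvalConst.continuous_eval_const t) continuous_const
  have hKc : ∀ g ∈ K, c ≤ J g := by
    intro g hg
    -- the end points are far from `A`, so the members of `K` are paths from `x₀` to `x₁`
    have h0 : g 0 = x₀ := by simpa using hg 0 (by simpa using hεx₀)
    have h1 : g 1 = x₁ := by simpa using hg 1 (by simpa using hεx₁)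
    obtain ⟨t, ht⟩ := hA.meets ⟨g, h0, h1⟩
    have ht' : g t ∈ A := ht
    refine le_trans ?_ (hGJ g t)
    simp only [G]
    rw [Metric.infDist_zero_of_mem ht', mul_zero, sub_zero]
    exact hA.le _ ht'
  have hJ₀ : J h₀ ≤ c + b * ε / 4 := ciSup_le fun t => by
    have := mul_nonneg hb.le (Metric.infDist_nonneg (x := h₀ t) (s := A))
    simp only [G]
    exact (sub_le_self _ this).trans (hh₀ t)
  obtain ⟨g, hgK, hg₀, hgmin⟩ := exists_ekeland hJ hK hKc hb (x₀ := (h₀ : C(unitInterval, M)))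
    fun t _ => rfl
  have hgc := hKc g hgK
  have hgJ : J g ≤ c + b * ε / 4 := by
    have := mul_nonneg hb.le (dist_nonneg (x := g) (y := (h₀ : C(unitInterval, M))))
    linarith
  have hdist : dist g (h₀ : C(unitInterval, M)) ≤ ε / 4 := by
    have : b * dist g (h₀ : C(unitInterval, M)) ≤ b * (ε / 4) := by linarith
    exact le_of_mul_le_mul_left this hb
  let T : Set unitInterval := {t | c - b * ε / 4 ≤ G (g t)}
  let Z : Set unitInterval := {t | ε ≤ Metric.infDist (h₀ t) A}
  have hT : IsCompact T := (isClosed_le continuous_const (hG.comp g.continuous)).isCompact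
  have hZ : IsClosed Z :=
    isClosed_le continuous_const ((Metric.continuous_infDist_pt A).comp h₀.continuous)
  have hTZ : Disjoint T Z := by
    refine disjoint_left.2 fun t ht htZ => ?_
    have h1 : c - b * ε / 4 ≤ φ (g t) - b * Metric.infDist (g t) A := ht
    rw [hgK t htZ] at h1
    have h2 : b * ε ≤ b * Metric.infDist (h₀ t) A := mul_le_mul_of_nonneg_left htZ hb.le
    linarith [hh₀ t]
  have hdesc : ∀ t ∈ T, DescendsAt φ σ (g t) := by
    intro t ht
    have h1 : c - b * ε / 4 ≤ φ (g t) - b * Metric.infDist (g t) A := ht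
    have h2 : φ (g t) - b * Metric.infDist (g t) A ≤ c + b * ε / 4 := (hGJ g t).trans hgJ
    have h3 : Metric.infDist (h₀ t) A < ε := not_le.1 (disjoint_left.1 hTZ ht)
    have h4 : Metric.infDist (g t) A ≤ Metric.infDist (h₀ t) A + dist (g t) (h₀ t) :=
      Metric.infDist_le_infDist_add_dist
    have h5 : dist (g t) (h₀ t) ≤ ε / 4 :=
      (ContinuousMap.dist_apply_le_dist (f := g) (g := (h₀ : C(unitInterval, M))) t).trans hdist
    have h6 : Metric.infDist (g t) A < ε₀ := by linarith
    have h7 : b * Metric.infDist (g t) A ≤ b * ε₀ := mul_le_mul_of_nonneg_left h6.le hb.le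
    have h8 := mul_nonneg hb.le (Metric.infDist_nonneg (x := g t) (s := A))
    exact h _ h6 (abs_lt.2 ⟨by linarith, by linarith⟩)
  obtain ⟨s₁, hs₁, hs⟩ := exists_isDescent hZ hT hTZ g hdesc
  obtain ⟨s, hs0, hss₁, hsε⟩ : ∃ s : ℝ, 0 < s ∧ s ≤ s₁ ∧ b * s ≤ b * ε / 4 := by
    refine ⟨min s₁ (ε / 4), by positivity, min_le_left _ _, ?_⟩
    rw [mul_div_assoc]
    exact mul_le_mul_of_nonneg_left (min_le_right _ _) hb.le
  obtain ⟨g', τ, hg', hτ⟩ := hs s hs0 hss₁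
  have hg'K : g' ∈ K := fun t ht => by
    have h1 := hg'.dist_le t
    rw [hg'.eq_zero t ht] at h1
    rw [dist_le_zero.1 h1, hgK t ht]
  have hGle : ∀ t, G (g' t) ≤ G (g t) - b * τ t := fun t => by
    have h1 : Metric.infDist (g t) A ≤ Metric.infDist (g' t) A + dist (g t) (g' t) :=
      Metric.infDist_le_infDist_add_dist
    have h2 := hg'.dist_le t
    rw [dist_comm] at h2
    have h3 : b * Metric.infDist (g t) A ≤ b * Metric.infDist (g' t) A + b * τ t := by
      rw [← mul_add]
      exact mul_le_mul_of_nonneg_left (h1.trans (by linarith)) hb.le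
    have h4 : 2 * b * τ t ≤ σ * τ t := mul_le_mul_of_nonneg_right hbσ (hg'.nonneg t)
    simp only [G]
    linarith [hg'.apply_le t]
  have hJ' : J g' ≤ J g - b * s := ciSup_le fun t => by
    by_cases ht : t ∈ T
    · have := hGle t
      rw [hτ t ht] at this
      linarith [hGJ g t]
    · have h1 : G (g t) < c - b * ε / 4 := not_le.1 ht
      linarith [hGle t, mul_nonneg hb.le (hg'.nonneg t)]
  have hdist' : dist g' g ≤ s :=
    (ContinuousMap.dist_le hs0.le).2 fun t => (hg'.dist_le t).trans (hg'.le t)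
  have heq : g' = g := hgmin g' hg'K (by linarith [mul_le_mul_of_nonneg_left hdist' hb.le])
  rw [heq] at hJ'
  linarith [mul_pos hb hs0]

/-- A map that lowers `φ` and fixes the end points pulls separating sets back to separating sets. -/
theorem IsSeparating.preimage (hA : IsSeparating φ c x₀ x₁ A) {η : M → M} (hη : Continuous η)
    (hle : ∀ w, φ (η w) ≤ φ w) (h₀ : η x₀ = x₀) (h₁ : η x₁ = x₁) :
    IsSeparating φ c x₀ x₁ (η ⁻¹' A) where
  isClosed := hA.isClosed.preimage hη
  le x hx := (hA.le _ hx).trans (hle x)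
  left h := hA.left (by rwa [mem_preimage, h₀] at h)
  right h := hA.right (by rwa [mem_preimage, h₁] at h)
  meets h := hA.meets ((h.map hη).cast h₀.symm h₁.symm)

/-- Near a point of descent, a separating set can be modified so as to avoid the level `c`. The
deformation `η` lowers `φ` strictly at the points that it moves, so the points of `η ⁻¹' A` at the
level `c` are fixed points of `η` in `A`. -/
theorem exists_isSeparating_nhds {σ : ℝ} (hσ : 0 < σ) {x : M} (hx₀ : x ≠ x₀) (hx₁ : x ≠ x₁)
    (h : DescendsTopologicallyAt φ σ x) :
    ∃ V ∈ 𝓝 x, ∀ A, IsSeparating φ c x₀ x₁ A →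
      ∃ A', IsSeparating φ c x₀ x₁ A' ∧ ∀ w ∈ A', φ w = c → w ∈ A ∧ w ∉ V := by
  obtain ⟨r, hr, H, h0, hc, hH⟩ := h
  obtain ⟨r', hr', hr'r, hr₀, hr₁⟩ : ∃ r' : ℝ, 0 < r' ∧ 2 * r' ≤ r ∧ r' ≤ dist x₀ x ∧
      r' ≤ dist x₁ x := by
    refine ⟨min (r / 2) (min (dist x₀ x) (dist x₁ x)), lt_min (by positivity)
      (lt_min (dist_pos.2 hx₀.symm) (dist_pos.2 hx₁.symm)), ?_,
      (min_le_right _ _).trans (min_le_left _ _), (min_le_right _ _).trans (min_le_right _ _)⟩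
    linarith [min_le_left (r / 2) (min (dist x₀ x) (dist x₁ x))]
  let θ : M → ℝ := fun w => max 0 (r' - dist w x)
  have hθ : Continuous θ := by fun_prop
  have hθr : ∀ w, θ w ∈ Icc 0 r := fun w =>
    ⟨le_max_left _ _, max_le hr.le (by linarith [dist_nonneg (x := w) (y := x)])⟩
  have hθ0 : ∀ w, r' ≤ dist w x → θ w = 0 := fun w hw => max_eq_left (by linarith)
  have hθC : ∀ w ∉ Metric.closedBall x r', θ w = 0 := fun w hw =>
    hθ0 w (not_le.1 (mt Metric.mem_closedBall.2 hw)).le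
  have hCO : Metric.closedBall x r' ⊆ Metric.ball x r :=
    Metric.closedBall_subset_ball (by linarith)
  let η : M → M := fun w => H w (θ w)
  have hη : Continuous η := continuous_deform h0 hc Metric.isOpen_ball continuous_id hθ hθr
    Metric.isClosed_closedBall hCO hθC
  have hηle : ∀ w, φ (η w) ≤ φ w - σ * θ w := fun w => by
    by_cases hw : w ∈ Metric.closedBall x r'
    · exact hH w (hCO hw) _ (hθr w)
    · simp [η, hθC w hw, h0]
  have hηfix : ∀ w, θ w = 0 → η w = w := fun w hw => by simp [η, hw, h0]
  refine ⟨Metric.ball x r', Metric.ball_mem_nhds x hr', fun A hA => ⟨η ⁻¹' A,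
    hA.preimage hη (fun w => ?_) (hηfix _ (hθ0 _ hr₀)) (hηfix _ (hθ0 _ hr₁)), fun w hw hwc => ?_⟩⟩
  · linarith [hηle w, mul_nonneg hσ.le (hθr w).1]
  · have h1 : c ≤ φ (η w) := hA.le _ hw
    have h2 : σ * θ w ≤ σ * 0 := by linarith [hηle w]
    have h3 : θ w = 0 := le_antisymm (le_of_mul_le_mul_left h2 hσ) (hθr w).1
    refine ⟨by rwa [mem_preimage, hηfix w h3] at hw, fun hwV => ?_⟩
    have h4 : r' - dist w x ≤ θ w := le_max_right _ _
    linarith [Metric.mem_ball.1 hwV]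

theorem exists_isSeparating_compact {K : Set M} (hK : IsCompact K) (hx₀ : x₀ ∉ K) (hx₁ : x₁ ∉ K)
    (h : ∀ x ∈ K, ∃ σ > 0, DescendsTopologicallyAt φ σ x) (hA : IsSeparating φ c x₀ x₁ A) :
    ∃ A', IsSeparating φ c x₀ x₁ A' ∧ ∀ w ∈ A', φ w = c → w ∈ A ∧ w ∉ K := by
  refine hK.induction_on (p := fun K => ∀ A, IsSeparating φ c x₀ x₁ A →
    ∃ A', IsSeparating φ c x₀ x₁ A' ∧ ∀ w ∈ A', φ w = c → w ∈ A ∧ w ∉ K) ?_ ?_ ?_ ?_ A hA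
  · exact fun A hA => ⟨A, hA, fun w hw _ => ⟨hw, notMem_empty w⟩⟩
  · intro s t hst ht A hA
    obtain ⟨A', hA', h'⟩ := ht A hA
    exact ⟨A', hA', fun w hw hwc => ⟨(h' w hw hwc).1, fun hws => (h' w hw hwc).2 (hst hws)⟩⟩
  · intro s t hs ht A hA
    obtain ⟨A₁, hA₁, h1⟩ := hs A hA
    obtain ⟨A₂, hA₂, h2⟩ := ht A₁ hA₁
    refine ⟨A₂, hA₂, fun w hw hwc => ?_⟩
    have h2' := h2 w hw hwc
    have h1' := h1 w h2'.1 hwc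
    exact ⟨h1'.1, fun hwst => hwst.elim h1'.2 h2'.2⟩
  · intro x hx
    obtain ⟨σ, hσ, hd⟩ := h x hx
    obtain ⟨V, hV, hV'⟩ := exists_isSeparating_nhds (c := c) hσ (ne_of_mem_of_not_mem hx hx₀)
      (ne_of_mem_of_not_mem hx hx₁) hd
    exact ⟨V, mem_nhdsWithin_of_mem_nhds hV, hV'⟩

/-- The Palais–Smale condition in terms of the weak slope. -/
def WeakSlopePalaisSmale (φ : M → ℝ) (c : ℝ) : Prop :=
  ∀ u : ℕ → M, Tendsto (fun j => φ (u j)) atTop (𝓝 c) →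
    (∀ σ > 0, ∀ᶠ j in atTop, ¬ DescendsAt φ σ (u j)) →
    ∃ x : M, ∃ s : ℕ → ℕ, StrictMono s ∧ Tendsto (u ∘ s) atTop (𝓝 x)

/-- A separating set contains a point of weak slope zero at the minimax level. -/
theorem IsSeparating.exists_not_descendsAt [CompleteSpace M] (hA : IsSeparating φ c x₀ x₁ A)
    (hφ : Continuous φ) (hc : ∀ ε > 0, ∃ h : Path x₀ x₁, ∀ t, φ (h t) ≤ c + ε)
    (hPS : WeakSlopePalaisSmale φ c) : ∃ x ∈ A, φ x = c ∧ ∀ σ > 0, ¬ DescendsAt φ σ x := by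
  by_contra! hcon
  have hAne : A.Nonempty := by
    obtain ⟨h₁, -⟩ := hc 1 one_pos
    obtain ⟨t, ht⟩ := hA.meets h₁
    exact ⟨_, ht⟩
  have hseq : ∀ n : ℕ, ∃ x, Metric.infDist x A < 1 / ((n : ℝ) + 1) ∧
      |φ x - c| < 1 / ((n : ℝ) + 1) ∧ ¬ DescendsAt φ (1 / ((n : ℝ) + 1)) x := by
    intro n
    by_contra! hn
    exact hA.not_uniform_descent hφ hc Nat.one_div_pos_of_nat Nat.one_div_pos_of_nat hn
  choose u hu1 hu2 hu3 using hseq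
  have hlim : Tendsto (fun n : ℕ => 1 / ((n : ℝ) + 1)) atTop (𝓝 0) :=
    tendsto_one_div_add_atTop_nhds_zero_nat
  have huc : Tendsto (fun n => φ (u n)) atTop (𝓝 c) := by
    rw [tendsto_iff_dist_tendsto_zero]
    exact squeeze_zero (fun _ => dist_nonneg) (fun n => (hu2 n).le) hlim
  have hslope : ∀ σ > 0, ∀ᶠ j in atTop, ¬ DescendsAt φ σ (u j) := fun σ hσ => by
    filter_upwards [hlim.eventually (gt_mem_nhds hσ)] with n hn hd
    exact hu3 n (hd.mono hn.le)
  obtain ⟨x, s, hs, hx⟩ := hPS u huc hslope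
  have hφx : φ x = c := tendsto_nhds_unique (hφ.continuousAt.tendsto.comp hx)
    (huc.comp hs.tendsto_atTop)
  have hxA : x ∈ A := by
    rw [hA.isClosed.mem_iff_infDist_zero hAne]
    refine tendsto_nhds_unique ((Metric.continuous_infDist_pt A).continuousAt.tendsto.comp hx) ?_
    exact (squeeze_zero (fun _ => Metric.infDist_nonneg) (fun n => (hu1 n).le) hlim).comp
      hs.tendsto_atTop
  obtain ⟨σ, hσ, hd⟩ := hcon x hxA hφx
  obtain ⟨n, hn1, hn2⟩ := ((hx.eventually hd.eventually).and
    (hs.tendsto_atTop.eventually (hslope σ hσ))).exists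
  exact hn2 hn1

/-- A separating set contains, at the minimax level, a point at which `φ` does not even descend
without distance control. The points of weak slope zero of `A` at this level form a compact set by
the Palais–Smale condition; if `φ` descended at all of them, `A` could be modified so as to avoid
them all. -/
theorem IsSeparating.exists_not_descendsTopologicallyAt [CompleteSpace M]
    (hA : IsSeparating φ c x₀ x₁ A) (hφ : Continuous φ)
    (hc : ∀ ε > 0, ∃ h : Path x₀ x₁, ∀ t, φ (h t) ≤ c + ε) (hPS : WeakSlopePalaisSmale φ c) :
    ∃ x ∈ A, φ x = c ∧ ∀ σ > 0, ¬ DescendsTopologicallyAt φ σ x := by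
  by_contra! hcon
  let K : Set M := {x | x ∈ A ∧ φ x = c ∧ ∀ σ > 0, ¬ DescendsAt φ σ x}
  have hK : IsCompact K := by
    refine IsSeqCompact.isCompact fun u hu => ?_
    have huc : Tendsto (fun n => φ (u n)) atTop (𝓝 c) :=
      tendsto_const_nhds.congr fun n => (hu n).2.1.symm
    obtain ⟨x, s, hs, hx⟩ := hPS u huc fun σ hσ => Eventually.of_forall fun n => (hu n).2.2 σ hσ
    refine ⟨x, ⟨?_, ?_, fun σ hσ hd => ?_⟩, s, hs, hx⟩
    · exact hA.isClosed.mem_of_tendsto hx (Eventually.of_forall fun n => (hu _).1)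
    · exact tendsto_nhds_unique (hφ.continuousAt.tendsto.comp hx) (huc.comp hs.tendsto_atTop)
    · obtain ⟨n, hn⟩ := (hx.eventually hd.eventually).exists
      exact (hu (s n)).2.2 σ hσ hn
  obtain ⟨A', hA', h'⟩ := exists_isSeparating_compact hK (fun h => hA.left h.1)
    (fun h => hA.right h.1) (fun x hx => hcon x hx.1 hx.2.1) hA
  obtain ⟨x, hxA', hxc, hxd⟩ := hA'.exists_not_descendsAt hφ hc hPS
  have hx := h' x hxA' hxc
  exact hx.2 ⟨hx.1, hxc, hxd⟩

end Minimax

/-! ### The Palais–Smale condition and the minimax level -/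

theorem IsC1Functional.continuous {F : Type*} [AddCommGroup F] [Module ℝ F] [TopologicalSpace F]
    {M : Type*} [TopologicalSpace M] [ChartedSpace F M] {φ : M → ℝ} (hφ : IsC1Functional F φ) :
    Continuous φ := by
  refine continuous_iff_continuousAt.2 fun x => ?_
  have hx := mem_chart_source F x
  have h1 : ContinuousAt (φ ∘ (chartAt F x).symm) (chartAt F x x) :=
    (hφ _ (chart_mem_atlas F x)).1.continuousAt
      ((chartAt F x).open_target.mem_nhds ((chartAt F x).map_source hx))
  refine (h1.comp ((chartAt F x).continuousAt hx)).congr ?_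
  filter_upwards [(chartAt F x).open_source.mem_nhds hx] with y hy
  simp [(chartAt F x).left_inv hy]

section Conclusion

variable {F : Type*} [AddCommGroup F] [Module ℝ F] [TopologicalSpace F] [IsTopologicalAddGroup F]
  [ContinuousSMul ℝ F] {M : Type*} [MetricSpace M] [ChartedSpace F M]

/-- `Φ_φ ≤ 0`, because the zero vector is admissible. -/
theorem FinslerStructure.Phi_nonpos (S : FinslerStructure F M) (φ : M → ℝ) (x : M) :
    S.Phi φ x ≤ 0 := by
  have h0 : (0 : ℝ) ∈ tangentDeriv F φ x '' S.unitBall x := by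
    refine ⟨0, fun n => by simp, ?_⟩
    simpa [tangentDeriv, dirDeriv] using (tendsto_const_nhds (x := (0 : ℝ))).limUnder_eq
  by_cases hb : BddBelow (tangentDeriv F φ x '' S.unitBall x)
  · exact csInf_le hb h0
  · exact (Real.sInf_of_not_bddBelow hb).le

theorem FinslerStructure.PalaisSmale.weakSlopePalaisSmale [LocallyConvexSpace ℝ F] [T2Space F]
    [FirstCountableTopology F] {S : FinslerStructure F M}
    (hS : ∀ x y : M, dist x y = S.finslerDist x y) {φ : M → ℝ} (hφ : IsC1Functional F φ) {c : ℝ}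
    (hPS : S.PalaisSmale φ c) : WeakSlopePalaisSmale φ c := by
  intro u huc hu
  refine hPS u huc ?_
  rw [tendsto_order]
  refine ⟨fun a ha => ?_, fun a ha => Eventually.of_forall fun j => (S.Phi_nonpos φ _).trans_lt ha⟩
  filter_upwards [hu (-a / 2 / 2) (by linarith)] with j hj
  by_contra! hle
  exact hj (S.descendsAt_of_Phi_lt hS hφ (by linarith))

end Conclusion

theorem exists_mem_frontier_of_path {M : Type*} [TopologicalSpace M] {U : Set M} {x₀ x₁ : M}
    (hx₀ : x₀ ∈ U) (hx₁ : x₁ ∉ U) (h : Path x₀ x₁) : ∃ t, h t ∈ frontier U := by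
  have hne : (frontier (h ⁻¹' U)).Nonempty := by
    refine nonempty_frontier_iff.2 ⟨⟨0, by simpa using hx₀⟩, fun huniv => hx₁ ?_⟩
    have : (1 : unitInterval) ∈ h ⁻¹' U := huniv ▸ mem_univ _
    simpa using this
  obtain ⟨t, ht⟩ := hne
  exact ⟨t, h.continuous.frontier_preimage_subset U ht⟩

end FrechetMPT

theorem theorem3p5
    -- the model space: a real Fréchet space
    {F : Type*} [AddCommGroup F] [Module ℝ F] [UniformSpace F] [IsUniformAddGroup F]
    [ContinuousSMul ℝ F] [LocallyConvexSpace ℝ F] [T2Space F] [FirstCountableTopology F]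
    [CompleteSpace F]
    -- a connected second countable `C¹` manifold whose metric is a complete Finsler metric
    {M : Type*} [MetricSpace M] [CompleteSpace M] [SecondCountableTopology M] [ConnectedSpace M]
    [ChartedSpace F M] (hM : FrechetMPT.IsC1Manifold F M)
    (S : FrechetMPT.FinslerStructure F M) (hS : ∀ x y : M, dist x y = S.finslerDist x y)
    (x₀ x₁ : M) (U : Set M) (hU : IsOpen U) (hx₀ : x₀ ∈ U) (hx₁ : x₁ ∉ closure U)
    (φ : M → ℝ) (hφ : FrechetMPT.IsC1Functional F φ) (hclosed : IsClosedMap φ)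
    (i : ℝ) (hi : IsGLB (φ '' frontier U) i) (hM1 : max (φ x₀) (φ x₁) ≤ i)
    (hPS : S.PalaisSmale φ (FrechetMPT.minimaxLevel φ x₀ x₁)) :
    -- the minimax level is a genuine infimum of a nonempty family of real suprema
    (Nonempty (Path x₀ x₁) ∧
      (∀ h : Path x₀ x₁, BddAbove (Set.range fun t : unitInterval => φ (h t))) ∧
      BddBelow (Set.range fun h : Path x₀ x₁ => ⨆ t : unitInterval, φ (h t))) ∧
    (FrechetMPT.criticalSet F φ (FrechetMPT.minimaxLevel φ x₀ x₁)).Nonempty ∧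
    i ≤ FrechetMPT.minimaxLevel φ x₀ x₁ ∧
    (FrechetMPT.minimaxLevel φ x₀ x₁ = i →
      (FrechetMPT.criticalSet F φ (FrechetMPT.minimaxLevel φ x₀ x₁) ∩ frontier U).Nonempty) := by

  set c := FrechetMPT.minimaxLevel φ x₀ x₁ with hcdef
  have hφc : Continuous φ := hφ.continuous
  have : LocallyPathConnectedSpace M := ChartedSpace.locallyPathConnectedSpace F M
  have : PathConnectedSpace M := pathConnectedSpace_iff_connectedSpace.2 inferInstance
  have hne : Nonempty (Path x₀ x₁) := PathConnectedSpace.joined x₀ x₁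
  have hbdd : ∀ h : Path x₀ x₁, BddAbove (Set.range fun t : unitInterval => φ (h t)) := fun h =>
    (isCompact_range (hφc.comp h.continuous)).bddAbove
  have hcross : ∀ h : Path x₀ x₁, ∃ t, h t ∈ frontier U :=
    FrechetMPT.exists_mem_frontier_of_path hx₀ fun h => hx₁ (subset_closure h)
  have hifr : ∀ x ∈ frontier U, i ≤ φ x := fun x hx => hi.1 ⟨x, hx, rfl⟩
  have hisup : ∀ h : Path x₀ x₁, i ≤ ⨆ t : unitInterval, φ (h t) := fun h => by
    obtain ⟨t, ht⟩ := hcross h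
    exact (hifr _ ht).trans (le_ciSup (hbdd h) t)
  have hbelow : BddBelow (Set.range fun h : Path x₀ x₁ => ⨆ t : unitInterval, φ (h t)) :=
    ⟨i, by rintro _ ⟨h, rfl⟩; exact hisup h⟩
  have hic : i ≤ c := le_ciInf hisup
  have happrox : ∀ ε > 0, ∃ h : Path x₀ x₁, ∀ t, φ (h t) ≤ c + ε := fun ε hε => by
    obtain ⟨h, hh⟩ := exists_lt_of_ciInf_lt (lt_add_of_pos_right c hε)
    exact ⟨h, fun t => (le_ciSup (hbdd h) t).trans hh.le⟩
  have key : ∀ A, FrechetMPT.IsSeparating φ c x₀ x₁ A →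
      (FrechetMPT.criticalSet F φ c ∩ A).Nonempty := fun A hA => by
    obtain ⟨x, hxA, hxc, hx⟩ := hA.exists_not_descendsTopologicallyAt hφc happrox
      (hPS.weakSlopePalaisSmale hS hφ)
    refine ⟨x, ⟨?_, hxc⟩, hxA⟩
    by_contra hcrit
    obtain ⟨σ, hσ, hd⟩ := FrechetMPT.descendsTopologicallyAt_of_not_isCriticalPt hφ hcrit
    exact hx σ hσ hd
  have hfr : c = i → (FrechetMPT.criticalSet F φ c ∩ frontier U).Nonempty := fun hci =>
    key _ ⟨isClosed_frontier, fun x hx => hci ▸ hifr x hx, fun h => (hU.frontier_eq ▸ h).2 hx₀,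
      fun h => hx₁ (frontier_subset_closure h), hcross⟩
  refine ⟨⟨hne, hbdd, hbelow⟩, ?_, hic, hfr⟩
  rcases hic.eq_or_lt with h | h
  · exact (hfr h.symm).left
  -- above the level `i` the superlevel set `{φ ≥ c}` separates the end points
  refine (key {x | c ≤ φ x} ⟨isClosed_le continuous_const hφc, fun x hx => hx,
    not_le.2 (((le_max_left _ _).trans hM1).trans_lt h),
    not_le.2 (((le_max_right _ _).trans hM1).trans_lt h), fun p => ?_⟩).left
  obtain ⟨t, -, ht⟩ := isCompact_univ.exists_isMaxOn univ_nonempty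
    (hφc.comp p.continuous).continuousOn
  exact ⟨t, (ciInf_le hbelow p).trans (ciSup_le fun s => ht (mem_univ s))⟩
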